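/- A \emph{quantum set} $\mathcal X$ is given by a set $\mathrm{At}(\mathcal X)$ of nonzero finite-dimensional complex Hilbert spaces, its \emph{atoms}. A \emph{binary relation} $R$ from $\mathcal X$ to $\mathcal Y$ assigns to atoms $X$ of $\mathcal X$ and $Y$ of $\mathcal Y$ a subspace $R(X,Y)\subseteq L(X,Y)$. Put $(S\circ R)(X,Z)=\mathrm{span}\{sr \mid s\in S(Y,Z),\ r\in R(X,Y),\ Y\in\mathrm{At}(\mathcal Y)\}$, $R^\dagger(Y,X)=\{v^\dagger\mid v\in R(X,Y)\}$, $I_{\mathcal X}(X,X)=\mathbb C\cdot 1_X$ and $I_{\mathcal X}(X,X')=0$ for $X\neq X'$; relations are ordered atomwise by inclusion. A \emph{function} from $\mathcal X$ to $\mathcal Y$ is a relation $F$ with $F^\dagger\circ F\ge I_{\mathcal X}$ and $F\circ F^\dagger\le I_{\mathcal Y}$; $\mathrm{Fun}(\mathcal X;\mathcal Y)$ is the set of these, and quantum sets with functions form a category. Let $\ell(\mathcal X)=\prod_{X\in\mathrm{At}(\mathcal X)}L(X)$, a unital $*$-algebra over $\mathbb C$. A function $F\colon\mathcal X\to\mathcal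 Y$ induces the unital $*$-homomorphism $F^\star\colon\ell(\mathcal Y)\to\ell(\mathcal X)$, $F^\star(b)(X)=\sum_Y\sum_{v}v^\dagger b(Y)v$, where $v$ runs over an orthonormal basis of $F(X,Y)$ for the inner product given by $(v|v')1_Y=v'v^\dagger$; thus $\ell(-)$ is a contravariant functor with $F\mapsto F^\star$. For an ordinary set $S$, let $`S$ be the quantum set with one one-dimensional atom $\mathbb C_s$ for each $s\in S$; for an ordinary function $f\colon S\to T$ let $`f\colon `S\to `T$ be the function with $`f(\mathbb C_s,\mathbb C_{f(s)})=L(\mathbb C_s,\mathbb C_{f(s)})$ and all other components $0$. Let $\mathbf 1$ be the quantum set with a single atom, which is one-dimensional. A \emph{total product} $\mathcal X*\mathcal Y$, with projections $Q_1,Q_2$, is a product in the category of quantum sets and functions; $\langle F_1,F_2\rangle$ denotes the induced function into it. Let $r\in\ell(`\mathbb R)$ be given by $r(\mathbb C_\alpha)=\alpha$. \textbf{Theorem.} A total product $\mathcal C=`\mathbb R*`\mathbb R$ exists. Let $\mathcal C$ be any such total product, and let $s=Q_1^\star(r)+iQ_2^\star(r)\in\ell(\mathcal C)$. Then a total product $\mathcal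 C*\mathcal C$ exists, and for any such total product there are unique functions $\boldsymbol+,\boldsymbol\cdot\colon\mathcal C*\mathcal C\to\mathcal C$ and $\overline{\phantom{s}}\colon\mathcal C\to\mathcal C$ with $$\boldsymbol+^\star(s)=Q_1^\star(s)+Q_2^\star(s),\qquad \boldsymbol\cdot^\star(s)=Q_1^\star(s)\,Q_2^\star(s),\qquad \overline{\phantom{s}}^{\,\star}(s)=s^\dagger .$$ For every quantum set $\mathcal X$, the set $\mathrm{Fun}(\mathcal X;\mathcal C)$ is a unital $*$-algebra over $\mathbb C$ with the operations $F_1+F_2=\boldsymbol+\circ\langle F_1,F_2\rangle$, $F_1\cdot F_2=\boldsymbol\cdot\circ\langle F_1,F_2\rangle$, $\overline{F}=\overline{\phantom{s}}\circ F$, in which each scalar $\alpha\in\mathbb C$ is the constant function $\mathrm{Cst}_\alpha$, the composition $\mathcal X\xrightarrow{!}\mathbf 1\xrightarrow{\alpha}`\mathbb C\xrightarrow{\langle `\mathrm{Re},`\mathrm{Im}\rangle}\mathcal C$ (so $\alpha F=\mathrm{Cst}_\alpha\cdot F$, $0=\mathrm{Cst}_0$, $1=\mathrm{Cst}_1$).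 With precomposition, $\mathrm{Fun}(-;\mathcal C)$ is a contravariant functor from the category of quantum sets and functions to the category of unital $*$-algebras over $\mathbb C$ and unital $*$-homomorphisms, and it is naturally isomorphic to $\ell(-)$; the natural isomorphism takes each function $F\colon\mathcal X\to\mathcal C$ to $F^\star(s)$. -/

import Mathlib

open CategoryTheory CategoryTheory.Limits
open scoped InnerProduct

universe u

namespace QuantumSets

/-- A quantum set: a set of nonzero finite-dimensional complex Hilbert spaces, its atoms. The set
of atoms is given as a family indexed by `At`, and two atoms are the same only if their indices
are. -/
structure QSet : Type (u + 1) where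
  At : Type u
  H : At → Type u
  [normed : ∀ a, NormedAddCommGroup (H a)]
  [innerProd : ∀ a, InnerProductSpace ℂ (H a)]
  [finDim : ∀ a, FiniteDimensional ℂ (H a)]
  [nontriv : ∀ a, Nontrivial (H a)]

attribute [instance] QSet.normed QSet.innerProd QSet.finDim QSet.nontriv

instance QSet.complete (X : QSet.{u}) (a : X.At) : CompleteSpace (X.H a) :=
  FiniteDimensional.complete ℂ (X.H a)

/-- Binary relations from `X` to `Y`, ordered atomwise by inclusion. -/
abbrev Rel (X Y : QSet.{u}) : Type u :=
  ∀ (a : X.At) (b : Y.At), Submodule ℂ (X.H a →L[ℂ] Y.H b)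

namespace Rel

variable {X Y Z W : QSet.{u}}

/-- The composition `S ∘ R`. -/
noncomputable def comp (S : Rel Y Z) (R : Rel X Y) : Rel X Z := fun a c =>
  Submodule.span ℂ {t | ∃ b, ∃ s ∈ S b c, ∃ r ∈ R a b, t = s ∘L r}

/-- The identity operator, regarded as an operator between equal atoms. -/
noncomputable def atomCast (X : QSet.{u}) {a a' : X.At} : a = a' → (X.H a →L[ℂ] X.H a')
  | rfl => ContinuousLinearMap.id ℂ (X.H a)

/-- The identity relation: `I(a, a)` is spanned by the identity operator, and `I(a, a') = 0` for
distinct atoms `a`, `a'`. -/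
noncomputable def id (X : QSet.{u}) : Rel X X := fun a a' =>
  Submodule.span ℂ {t | ∃ h : a = a', t = atomCast X h}

/-- The adjoint relation `R†(b, a) = {v† | v ∈ R(a, b)}`. -/
noncomputable def dagger (R : Rel X Y) : Rel Y X := fun b a =>
  (R a b).map
    (ContinuousLinearMap.adjoint (𝕜 := ℂ) (E := X.H a) (F := Y.H b)).toLinearEquiv.toLinearMap

/-- A function between quantum sets: `F† ∘ F ≥ I` and `F ∘ F† ≤ I`. -/
def IsFun (F : Rel X Y) : Prop :=
  id X ≤ comp (dagger F) F ∧ comp F (dagger F) ≤ id Y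

theorem mem_dagger {R : Rel X Y} {a : X.At} {b : Y.At} {w : Y.H b →L[ℂ] X.H a} :
    w ∈ dagger R b a ↔ w† ∈ R a b := by
  constructor
  · rintro ⟨v, hv, rfl⟩
    simpa using hv
  · intro h
    exact ⟨w†, h, by simp⟩

theorem comp_mem {S : Rel Y Z} {R : Rel X Y} {a : X.At} {b : Y.At} {c : Z.At}
    {s : Y.H b →L[ℂ] Z.H c} {r : X.H a →L[ℂ] Y.H b} (hs : s ∈ S b c) (hr : r ∈ R a b) :
    s ∘L r ∈ comp S R a c :=
  Submodule.subset_span ⟨b, s, hs, r, hr, rfl⟩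

theorem comp_le {S : Rel Y Z} {R : Rel X Y} {T : Rel X Z}
    (h : ∀ a b c, ∀ s ∈ S b c, ∀ r ∈ R a b, s ∘L r ∈ T a c) : comp S R ≤ T := by
  intro a c
  refine Submodule.span_le.2 ?_
  rintro t ⟨b, s, hs, r, hr, rfl⟩
  exact h a b c s hs r hr

theorem comp_mono {S S' : Rel Y Z} {R R' : Rel X Y} (hS : S ≤ S') (hR : R ≤ R') :
    comp S R ≤ comp S' R' :=
  comp_le fun a b c _ hs _ hr => comp_mem (hS b c hs) (hR a b hr)

theorem comp_assoc (T : Rel Z W) (S : Rel Y Z) (R : Rel X Y) :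
    comp (comp T S) R = comp T (comp S R) := by
  apply le_antisymm
  · refine comp_le fun a b d s hs r hr => ?_
    induction hs using Submodule.span_induction with
    | mem x hx =>
      obtain ⟨c, t, ht, s, hs, rfl⟩ := hx
      exact comp_mem (b := c) ht (comp_mem hs hr)
    | zero => simp
    | add x y _ _ hx hy => rw [ContinuousLinearMap.add_comp]; exact add_mem hx hy
    | smul k x _ hx => rw [ContinuousLinearMap.smul_comp]; exact Submodule.smul_mem _ _ hx
  · refine comp_le fun a c d t ht s hs => ?_
    induction hs using Submodule.span_induction with
    | mem x hx =>
      obtain ⟨b, s, hs, r, hr, rfl⟩ := hx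
      exact comp_mem (b := b) (comp_mem ht hs) hr
    | zero => simp
    | add x y _ _ hx hy => rw [ContinuousLinearMap.comp_add]; exact add_mem hx hy
    | smul k x _ hx => rw [ContinuousLinearMap.comp_smul]; exact Submodule.smul_mem _ _ hx

theorem one_mem_id (a : X.At) : ContinuousLinearMap.id ℂ (X.H a) ∈ id X a a :=
  Submodule.subset_span ⟨rfl, rfl⟩

theorem id_le {T : Rel X X} (h : ∀ a, ContinuousLinearMap.id ℂ (X.H a) ∈ T a a) : id X ≤ T := by
  intro a a'
  refine Submodule.span_le.2 ?_
  rintro t ⟨rfl, rfl⟩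
  exact h a

theorem id_comp (R : Rel X Y) : comp (id Y) R = R := by
  apply le_antisymm
  · refine comp_le fun a b c s hs r hr => ?_
    induction hs using Submodule.span_induction with
    | mem x hx => obtain ⟨rfl, rfl⟩ := hx; exact hr
    | zero => simp
    | add x y _ _ hx hy => rw [ContinuousLinearMap.add_comp]; exact add_mem hx hy
    | smul k x _ hx => rw [ContinuousLinearMap.smul_comp]; exact Submodule.smul_mem _ _ hx
  · intro a b r hr
    exact comp_mem (b := b) (one_mem_id b) hr

theorem comp_id (R : Rel X Y) : comp R (id X) = R := by
  apply le_antisymm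
  · refine comp_le fun a b c s hs r hr => ?_
    induction hr using Submodule.span_induction with
    | mem x hx => obtain ⟨rfl, rfl⟩ := hx; exact hs
    | zero => simp
    | add x y _ _ hx hy => rw [ContinuousLinearMap.comp_add]; exact add_mem hx hy
    | smul k x _ hx => rw [ContinuousLinearMap.comp_smul]; exact Submodule.smul_mem _ _ hx
  · intro a b r hr
    exact comp_mem (b := a) hr (one_mem_id a)

theorem dagger_dagger (R : Rel X Y) : dagger (dagger R) = R := by
  funext a b
  ext v
  simp [mem_dagger]

theorem dagger_mono {R S : Rel X Y} (h : R ≤ S) : dagger R ≤ dagger S := by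
  intro b a w hw
  exact mem_dagger.2 (h a b (mem_dagger.1 hw))

theorem dagger_comp (S : Rel Y Z) (R : Rel X Y) :
    dagger (comp S R) = comp (dagger R) (dagger S) := by
  have key : ∀ {X Y Z : QSet.{u}} (S : Rel Y Z) (R : Rel X Y),
      comp S R ≤ dagger (comp (dagger R) (dagger S)) := by
    intro X Y Z S R
    refine comp_le fun a b c s hs r hr => ?_
    rw [mem_dagger, ContinuousLinearMap.adjoint_comp]
    exact comp_mem (b := b) (mem_dagger.2 (by simpa using hr)) (mem_dagger.2 (by simpa using hs))
  apply le_antisymm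
  · have := dagger_mono (key S R)
    rwa [dagger_dagger] at this
  · have := key (dagger R) (dagger S)
    rwa [dagger_dagger, dagger_dagger] at this

theorem dagger_id (X : QSet.{u}) : dagger (id X) = id X := by
  have key : id X ≤ dagger (id X) :=
    id_le fun a => mem_dagger.2 (by rw [ContinuousLinearMap.adjoint_id]; exact one_mem_id a)
  apply le_antisymm
  · have := dagger_mono key
    rwa [dagger_dagger] at this
  · exact key

theorem isFun_id (X : QSet.{u}) : IsFun (id X) := by
  constructor <;> rw [dagger_id, id_comp]

theorem IsFun.comp {G : Rel Y Z} {F : Rel X Y} (hG : IsFun G) (hF : IsFun F) :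
    IsFun (Rel.comp G F) := by
  constructor
  · rw [dagger_comp, comp_assoc, ← comp_assoc (dagger G)]
    refine hF.1.trans (comp_mono le_rfl ?_)
    conv_lhs => rw [← id_comp F]
    exact comp_mono hG.1 le_rfl
  · rw [dagger_comp, comp_assoc, ← comp_assoc F]
    refine le_trans (comp_mono le_rfl ?_) hG.2
    conv_rhs => rw [← id_comp (dagger G)]
    exact comp_mono hF.2 le_rfl

end Rel

/-- The set `Fun(X; Y)` of functions from `X` to `Y`. -/
@[ext]
structure Fun (X Y : QSet.{u}) : Type u where
  rel : Rel X Y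
  isFun : rel.IsFun

/-- The category of quantum sets and functions. Here `F ≫ G` is the composition `G ∘ F`. -/
noncomputable instance : Category.{u} QSet.{u} where
  Hom X Y := Fun X Y
  id X := ⟨Rel.id X, Rel.isFun_id X⟩
  comp F G := ⟨Rel.comp G.rel F.rel, G.isFun.comp F.isFun⟩
  id_comp F := Fun.ext (Rel.comp_id F.rel)
  comp_id F := Fun.ext (Rel.id_comp F.rel)
  assoc F G K := Fun.ext (Rel.comp_assoc K.rel G.rel F.rel).symm

/-- The `*`-algebra `ℓ(X)`, the product of the algebras of operators on the atoms of `X`. -/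
abbrev ell (X : QSet.{u}) : Type u := ∀ a : X.At, X.H a →L[ℂ] X.H a

theorem exists_orthonormalBasis_core {V : Type u} [AddCommGroup V] [Module ℂ V]
    [FiniteDimensional ℂ V] (core : InnerProductSpace.Core ℂ V) :
    ∃ (n : ℕ) (B : Module.Basis (Fin n) ℂ V), ∀ i j,
      core.inner (B i) (B j) = if i = j then 1 else 0 := by
  let _ : NormedAddCommGroup V := core.toNormedAddCommGroup
  let _ : InnerProductSpace ℂ V := InnerProductSpace.ofCore core.toCore
  let B := stdOrthonormalBasis ℂ V
  refine ⟨_, B.toBasis, fun i j => ?_⟩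
  rw [OrthonormalBasis.coe_toBasis]
  exact orthonormal_iff_ite.1 B.orthonormal i j

/-- The inner product `(v | v')` on a space `V` of operators with `V V† ≤ ℂ 1`, which is
characterized by `(v | v') 1 = v' v†`, admits an orthonormal basis. -/
theorem exists_orthonormalBasis {H K : Type u}
    [NormedAddCommGroup H] [InnerProductSpace ℂ H] [FiniteDimensional ℂ H] [CompleteSpace H]
    [NormedAddCommGroup K] [InnerProductSpace ℂ K] [FiniteDimensional ℂ K] [CompleteSpace K]
    [Nontrivial K] (V : Submodule ℂ (H →L[ℂ] K))
    (hV : ∀ v ∈ V, ∀ w ∈ V, ∃ c : ℂ, w ∘L v† = c • ContinuousLinearMap.id ℂ K) :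
    ∃ (n : ℕ) (B : Module.Basis (Fin n) ℂ V), ∀ i j,
      (B j : H →L[ℂ] K) ∘L (B i : H →L[ℂ] K)† =
        if i = j then ContinuousLinearMap.id ℂ K else 0 := by
  have hid : ContinuousLinearMap.id ℂ K ≠ 0 := by
    obtain ⟨y, hy⟩ := exists_ne (0 : K)
    exact fun h => hy (by simpa using congrArg (fun f : K →L[ℂ] K => f y) h)
  have inj : ∀ {c d : ℂ}, c • ContinuousLinearMap.id ℂ K = d • ContinuousLinearMap.id ℂ K → c = d :=
    fun h => smul_left_injective ℂ hid h
  choose c hc using fun v w : V => hV v v.2 w w.2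
  have hnorm : ∀ (v : V) (y : K), c v v * (‖y‖ ^ 2 : ℝ) = (‖((v : H →L[ℂ] K)†) y‖ ^ 2 : ℝ) := by
    intro v y
    have h1 := congrArg (fun f : K →L[ℂ] K => inner ℂ y (f y)) (hc v v)
    simp only [ContinuousLinearMap.comp_apply, _root_.smul_apply,
      ContinuousLinearMap.id_apply, inner_smul_right] at h1
    rw [← ContinuousLinearMap.adjoint_inner_left, inner_self_eq_norm_sq_to_K,
      inner_self_eq_norm_sq_to_K] at h1
    push_cast
    exact h1.symm
  obtain ⟨y₀, hy₀⟩ := exists_ne (0 : K)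
  let core : InnerProductSpace.Core ℂ V :=
    { inner := c
      conj_inner_symm := fun v w => inj (by
        have h := congrArg ContinuousLinearMap.adjoint (hc w v)
        rw [ContinuousLinearMap.adjoint_comp, ContinuousLinearMap.adjoint_adjoint, map_smulₛₗ,
          ContinuousLinearMap.adjoint_id, hc v w] at h
        exact h.symm)
      re_inner_nonneg := fun v => by
        have h := hnorm v y₀
        have h2 : (c v v).re * ‖y₀‖ ^ 2 = ‖((v : H →L[ℂ] K)†) y₀‖ ^ 2 := by
          have := congrArg Complex.re h
          rwa [Complex.re_mul_ofReal, Complex.ofReal_re] at this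
        have h3 : 0 < ‖y₀‖ ^ 2 := by positivity
        have h4 : 0 ≤ ‖((v : H →L[ℂ] K)†) y₀‖ ^ 2 := by positivity
        rw [← h2] at h4
        exact nonneg_of_mul_nonneg_left h4 h3
      add_left := fun v w z => inj (by
        rw [add_smul, ← hc, ← hc, ← hc, Submodule.coe_add, map_add, ContinuousLinearMap.comp_add])
      smul_left := fun v w r => inj (by
        rw [mul_smul, ← hc, ← hc, Submodule.coe_smul, map_smulₛₗ, ContinuousLinearMap.comp_smul])
      definite := fun v hv => by
        have h0 : (v : H →L[ℂ] K)† = 0 := by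
          ext y
          have h := hnorm v y
          have hv' : c v v = 0 := hv
          rw [hv', zero_mul] at h
          have h2 : ‖((v : H →L[ℂ] K)†) y‖ ^ 2 = 0 := by exact_mod_cast h.symm
          simpa using h2
        have h1 := congrArg ContinuousLinearMap.adjoint h0
        rw [ContinuousLinearMap.adjoint_adjoint, map_zero] at h1
        exact Subtype.ext h1 }
  obtain ⟨n, B, hB⟩ := exists_orthonormalBasis_core core
  refine ⟨n, B, fun i j => ?_⟩
  have h1 : c (B i) (B j) = if i = j then 1 else 0 := hB i j
  rw [hc, h1]
  split_ifs <;> simp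

namespace Fun

variable {X Y Z : QSet.{u}}

theorem rel_coisometric (F : Fun X Y) (a : X.At) (b : Y.At) :
    ∀ v ∈ F.rel a b, ∀ w ∈ F.rel a b,
      ∃ c : ℂ, w ∘L v† = c • ContinuousLinearMap.id ℂ (Y.H b) := by
  intro v hv w hw
  have h := F.isFun.2 b b
    (Rel.comp_mem (b := a) hw (Rel.mem_dagger.2 (by simpa using hv) : v† ∈ Rel.dagger F.rel b a))
  have h2 : Rel.id Y b b ≤ Submodule.span ℂ {ContinuousLinearMap.id ℂ (Y.H b)} :=
    Submodule.span_mono (by rintro t ⟨_, rfl⟩; rfl)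
  obtain ⟨c, hc⟩ := Submodule.mem_span_singleton.1 (h2 h)
  exact ⟨c, hc.symm⟩

theorem rel_orthogonal (F : Fun X Y) (a : X.At) {b b' : Y.At} (hb : b ≠ b')
    {v : X.H a →L[ℂ] Y.H b} (hv : v ∈ F.rel a b) {w : X.H a →L[ℂ] Y.H b'} (hw : w ∈ F.rel a b') :
    w ∘L v† = 0 := by
  have h := F.isFun.2 b b'
    (Rel.comp_mem (b := a) hw (Rel.mem_dagger.2 (by simpa using hv) : v† ∈ Rel.dagger F.rel b a))
  have h2 : Rel.id Y b b' ≤ ⊥ := Submodule.span_le.2 (by rintro t ⟨h, _⟩; exact absurd h hb)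
  simpa using h2 h

/-- The dimension of `F(a, b)`. -/
noncomputable def mult (F : Fun X Y) (a : X.At) (b : Y.At) : ℕ :=
  (exists_orthonormalBasis (F.rel a b) (F.rel_coisometric a b)).choose

/-- An orthonormal basis of `F(a, b)` for the inner product `(v | v') 1 = v' v†`. -/
noncomputable def basis (F : Fun X Y) (a : X.At) (b : Y.At) :
    Module.Basis (Fin (F.mult a b)) ℂ (F.rel a b) :=
  (exists_orthonormalBasis (F.rel a b) (F.rel_coisometric a b)).choose_spec.choose

theorem basis_orthonormal (F : Fun X Y) (a : X.At) (b : Y.At) (i j : Fin (F.mult a b)) :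
    (F.basis a b j : X.H a →L[ℂ] Y.H b) ∘L (F.basis a b i : X.H a →L[ℂ] Y.H b)† =
      if i = j then ContinuousLinearMap.id ℂ (Y.H b) else 0 :=
  (exists_orthonormalBasis (F.rel a b) (F.rel_coisometric a b)).choose_spec.choose_spec i j

/-- The map underlying `F^⋆ : ℓ(Y) → ℓ(X)`: the component of `F^⋆(y)` at an atom `a` is the sum
of `v† y(b) v`, with `b` ranging over the atoms of `Y` and `v` over an orthonormal basis of
`F(a, b)`. Only finitely many terms are nonzero, by `finite_support`. -/
noncomputable def pullFun (F : Fun X Y) (y : ell Y) : ell X := fun a =>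
  ∑ᶠ b : Y.At, ∑ i : Fin (F.mult a b),
    (F.basis a b i : X.H a →L[ℂ] Y.H b)† ∘L y b ∘L (F.basis a b i : X.H a →L[ℂ] Y.H b)

theorem finite_support (F : Fun X Y) (a : X.At) : {b : Y.At | F.rel a b ≠ ⊥}.Finite := by
  have h1 : ∀ b : {b : Y.At | F.rel a b ≠ ⊥}, ∃ v ∈ F.rel a b, ∃ y, (v†) y ≠ 0 := by
    rintro ⟨b, hb⟩
    obtain ⟨v, hv, hv0⟩ := (Submodule.ne_bot_iff _).1 hb
    refine ⟨v, hv, ?_⟩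
    by_contra! h
    have h2 : v† = 0 := by ext y; simpa using h y
    have h3 := congrArg ContinuousLinearMap.adjoint h2
    rw [ContinuousLinearMap.adjoint_adjoint, map_zero] at h3
    exact hv0 h3
  choose v hv y hy using h1
  have li : LinearIndependent ℂ
      (fun b : {b : Y.At | F.rel a b ≠ ⊥} => ((v b)†) (y b)) := by
    refine linearIndependent_of_ne_zero_of_inner_eq_zero (𝕜 := ℂ) hy ?_
    intro b b' hbb
    have h0 := F.rel_orthogonal a (fun h => hbb (Subtype.ext h)) (hv b) (hv b')
    have h1 := congrArg (fun f => f (y b)) h0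
    simp only [ContinuousLinearMap.comp_apply] at h1
    rw [ContinuousLinearMap.adjoint_inner_right, h1]
    simp
  have := li.finite
  exact Set.toFinite _

theorem pullFun_eq_sum (F : Fun X Y) (y : ell Y) (a : X.At) :
    F.pullFun y a = ∑ b ∈ (F.finite_support a).toFinset, ∑ i : Fin (F.mult a b),
      (F.basis a b i : X.H a →L[ℂ] Y.H b)† ∘L y b ∘L (F.basis a b i : X.H a →L[ℂ] Y.H b) := by
  refine finsum_eq_sum_of_support_subset _ ?_
  intro b hb
  simp only [Set.Finite.coe_toFinset, Set.mem_ofPred_eq]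
  intro h
  refine hb (Finset.sum_eq_zero fun i _ => ?_)
  rw [(Submodule.eq_bot_iff _).1 h _ (F.basis a b i).2]
  simp

/-- `F^⋆(y)` intertwines the operators in `F`. -/
theorem comp_pullFun (F : Fun X Y) (y : ell Y) {a : X.At} {b : Y.At}
    {v : X.H a →L[ℂ] Y.H b} (hv : v ∈ F.rel a b) :
    v ∘L F.pullFun y a = y b ∘L v := by
  have key : ∀ j, (F.basis a b j : X.H a →L[ℂ] Y.H b) ∘L F.pullFun y a =
      y b ∘L (F.basis a b j : X.H a →L[ℂ] Y.H b) := by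
    intro j
    rw [pullFun_eq_sum, ContinuousLinearMap.comp_finsetSum]
    rw [Finset.sum_eq_single b]
    · rw [ContinuousLinearMap.comp_finsetSum, Finset.sum_eq_single j]
      · rw [← ContinuousLinearMap.comp_assoc, basis_orthonormal, if_pos rfl,
          ContinuousLinearMap.id_comp]
      · intro i _ hij
        rw [← ContinuousLinearMap.comp_assoc, basis_orthonormal, if_neg hij,
          ContinuousLinearMap.zero_comp]
      · simp
    · intro b' _ hb'
      rw [ContinuousLinearMap.comp_finsetSum]
      refine Finset.sum_eq_zero fun i _ => ?_
      rw [← ContinuousLinearMap.comp_assoc,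
        F.rel_orthogonal a hb' (F.basis a b' i).2 (F.basis a b j).2,
        ContinuousLinearMap.zero_comp]
    · intro hb
      exfalso
      apply hb
      simp only [Set.Finite.mem_toFinset, Set.mem_ofPred_eq]
      intro h
      exact (F.basis a b).ne_zero j
        (Subtype.ext ((Submodule.eq_bot_iff _).1 h _ (F.basis a b j).2))
  have h := (F.basis a b).mem_span ⟨v, hv⟩
  have key2 : ∀ w : F.rel a b, w ∈ Submodule.span ℂ (Set.range (F.basis a b)) →
      (w : X.H a →L[ℂ] Y.H b) ∘L F.pullFun y a = y b ∘L (w : X.H a →L[ℂ] Y.H b) := by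
    intro w hw
    induction hw using Submodule.span_induction with
    | mem x hx => obtain ⟨j, rfl⟩ := hx; exact key j
    | zero => simp
    | add x z _ _ hx hz =>
      rw [Submodule.coe_add, ContinuousLinearMap.add_comp, ContinuousLinearMap.comp_add, hx, hz]
    | smul k x _ hx =>
      rw [Submodule.coe_smul, ContinuousLinearMap.smul_comp, ContinuousLinearMap.comp_smul, hx]
  exact key2 ⟨v, hv⟩ h

/-- The operators in a function separate operators. -/
theorem eq_of_comp_eq (F : Fun X Y) {a : X.At} {t t' : X.H a →L[ℂ] X.H a}
    (h : ∀ b, ∀ v ∈ F.rel a b, v ∘L t = v ∘L t') : t = t' := by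
  have h1 := F.isFun.1 a a (Rel.one_mem_id a)
  have h2 : ∀ s ∈ Rel.comp (Rel.dagger F.rel) F.rel a a, s ∘L t = s ∘L t' := by
    intro s hs
    induction hs using Submodule.span_induction with
    | mem x hx =>
      obtain ⟨b, w, _, v, hv, rfl⟩ := hx
      rw [ContinuousLinearMap.comp_assoc, ContinuousLinearMap.comp_assoc, h b v hv]
    | zero => simp
    | add x z _ _ hx hz =>
      rw [ContinuousLinearMap.add_comp, ContinuousLinearMap.add_comp, hx, hz]
    | smul k x _ hx =>
      rw [ContinuousLinearMap.smul_comp, ContinuousLinearMap.smul_comp, hx]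
  simpa using h2 _ h1

theorem pullFun_eq (F : Fun X Y) {y : ell Y} {x : ell X}
    (h : ∀ a b, ∀ v ∈ F.rel a b, v ∘L x a = y b ∘L v) : F.pullFun y = x := by
  funext a
  exact F.eq_of_comp_eq fun b v hv => by rw [F.comp_pullFun y hv, h a b v hv]

/-- The unital `*`-homomorphism `F^⋆ : ℓ(Y) → ℓ(X)` of a function `F` from `X` to `Y`. -/
noncomputable def pull (F : Fun X Y) : ell Y →⋆ₐ[ℂ] ell X where
  toFun := F.pullFun
  map_one' := F.pullFun_eq fun a b v _ => by
    simp only [Pi.one_apply, ContinuousLinearMap.one_def, ContinuousLinearMap.comp_id,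
      ContinuousLinearMap.id_comp]
  map_zero' := F.pullFun_eq fun a b v _ => by simp
  map_add' y z := F.pullFun_eq fun a b v hv => by
    rw [Pi.add_apply, Pi.add_apply, ContinuousLinearMap.comp_add, ContinuousLinearMap.add_comp,
      F.comp_pullFun y hv, F.comp_pullFun z hv]
  map_mul' y z := F.pullFun_eq fun a b v hv => by
    rw [Pi.mul_apply, Pi.mul_apply, ContinuousLinearMap.mul_def, ContinuousLinearMap.mul_def,
      ← ContinuousLinearMap.comp_assoc, F.comp_pullFun y hv, ContinuousLinearMap.comp_assoc,
      F.comp_pullFun z hv, ContinuousLinearMap.comp_assoc]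
  commutes' c := F.pullFun_eq fun a b v _ => by
    simp only [Pi.algebraMap_apply, Algebra.algebraMap_eq_smul_one, ContinuousLinearMap.one_def,
      ContinuousLinearMap.comp_smul, ContinuousLinearMap.smul_comp, ContinuousLinearMap.comp_id,
      ContinuousLinearMap.id_comp]
  map_star' y := by
    funext a
    rw [Pi.star_apply, pullFun_eq_sum, pullFun_eq_sum, star_sum]
    refine Finset.sum_congr rfl fun b _ => ?_
    rw [star_sum]
    refine Finset.sum_congr rfl fun i _ => ?_
    rw [ContinuousLinearMap.star_eq_adjoint, ContinuousLinearMap.adjoint_comp,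
      ContinuousLinearMap.adjoint_comp, ContinuousLinearMap.adjoint_adjoint, Pi.star_apply,
      ContinuousLinearMap.star_eq_adjoint, ContinuousLinearMap.comp_assoc]

theorem pull_id (X : QSet.{u}) : pull (𝟙 X) = StarAlgHom.id ℂ (ell X) := by
  refine StarAlgHom.ext fun x => ?_
  refine pullFun_eq _ fun a b v hv => ?_
  change v ∈ Rel.id X a b at hv
  change v ∘L x a = x b ∘L v
  induction hv using Submodule.span_induction with
  | mem t ht => obtain ⟨rfl, rfl⟩ := ht; rfl
  | zero => simp
  | add s t _ _ hs ht =>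
    rw [ContinuousLinearMap.add_comp, ContinuousLinearMap.comp_add, hs, ht]
  | smul k t _ ht => rw [ContinuousLinearMap.smul_comp, ContinuousLinearMap.comp_smul, ht]

theorem pull_comp (F : X ⟶ Y) (G : Y ⟶ Z) : pull (F ≫ G) = (pull F).comp (pull G) := by
  refine StarAlgHom.ext fun z => ?_
  refine pullFun_eq _ fun a c t ht => ?_
  change t ∈ Rel.comp G.rel F.rel a c at ht
  change t ∘L F.pullFun (G.pullFun z) a = z c ∘L t
  induction ht using Submodule.span_induction with
  | mem t ht =>
    obtain ⟨b, w, hw, v, hv, rfl⟩ := ht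
    rw [ContinuousLinearMap.comp_assoc, F.comp_pullFun _ hv, ← ContinuousLinearMap.comp_assoc,
      G.comp_pullFun _ hw, ContinuousLinearMap.comp_assoc]
  | zero => simp
  | add s t _ _ hs ht =>
    rw [ContinuousLinearMap.add_comp, ContinuousLinearMap.comp_add, hs, ht]
  | smul k t _ ht => rw [ContinuousLinearMap.smul_comp, ContinuousLinearMap.comp_smul, ht]

end Fun

/-- A unital `*`-algebra over `ℂ`. -/
structure StarAlgCat : Type (u + 1) where
  carrier : Type u
  [ring : Ring carrier]
  [algebra : Algebra ℂ carrier]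
  [starRing : StarRing carrier]
  [starModule : StarModule ℂ carrier]

attribute [instance] StarAlgCat.ring StarAlgCat.algebra StarAlgCat.starRing StarAlgCat.starModule

/-- The category of unital `*`-algebras over `ℂ` and unital `*`-homomorphisms. -/
instance : Category.{u} StarAlgCat.{u} where
  Hom A B := A.carrier →⋆ₐ[ℂ] B.carrier
  id A := StarAlgHom.id ℂ A.carrier
  comp f g := StarAlgHom.comp g f

/-- The value of a morphism of unital `*`-algebras at an element. -/
def StarAlgCat.apply {A B : StarAlgCat.{u}} (f : A ⟶ B) (a : A.carrier) : B.carrier :=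
  (show A.carrier →⋆ₐ[ℂ] B.carrier from f) a

/-- The contravariant functor `ℓ(−)`, with `F ↦ F^⋆` on functions. -/
noncomputable def ellFunctor : QSet.{u}ᵒᵖ ⥤ StarAlgCat.{u} where
  obj X := ⟨ell X.unop⟩
  map F := Fun.pull F.unop
  map_id X := Fun.pull_id X.unop
  map_comp F G := Fun.pull_comp G.unop F.unop

/-- The quantum set `` `S `` of an ordinary set `S`: one atom `ℓ²({s})` for each `s ∈ S`. -/
noncomputable abbrev classical (S : Type u) : QSet.{u} where
  At := S
  H _ := EuclideanSpace ℂ PUnit.{u + 1}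

/-- The terminal quantum set `1`, with a single atom, which is one-dimensional. -/
noncomputable abbrev unit : QSet.{u} := classical PUnit.{u + 1}

/-- An operator on a one-dimensional atom is in the identity relation. -/
theorem mem_id_of_finrank {Y : QSet.{u}} {b : Y.At} (hb : Module.finrank ℂ (Y.H b) = 1)
    (t : Y.H b →L[ℂ] Y.H b) : t ∈ Rel.id Y b b := by
  obtain ⟨e, he, h⟩ := finrank_eq_one_iff'.1 hb
  obtain ⟨c, hc⟩ := h (t e)
  have : t = c • ContinuousLinearMap.id ℂ (Y.H b) := by
    ext x
    obtain ⟨d, rfl⟩ := h x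
    rw [map_smul, ← hc, _root_.smul_apply, ContinuousLinearMap.id_apply, smul_comm]
  rw [this]
  exact Submodule.smul_mem _ c (Rel.one_mem_id b)

theorem classical_finrank {S : Type u} (s : (classical S).At) :
    Module.finrank ℂ ((classical S).H s) = 1 := by
  change Module.finrank ℂ (EuclideanSpace ℂ PUnit.{u + 1}) = 1
  simp

theorem unit_finrank (s : unit.{u}.At) : Module.finrank ℂ (unit.H s) = 1 :=
  classical_finrank (S := PUnit.{u + 1}) s

open Classical in
/-- The function `` `f `` from `` `S `` to `` `T `` of an ordinary function `f : S → T`. -/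
noncomputable def classicalMap {S T : Type u} (f : S → T) : classical S ⟶ classical T where
  rel := fun s t => if f s = t then ⊤ else ⊥
  isFun := by
    constructor
    · refine Rel.id_le fun s => ?_
      have h := Rel.comp_mem (X := classical S) (Y := classical T) (Z := classical S)
        (S := Rel.dagger (X := classical S) (Y := classical T)
          (fun s t => if f s = t then ⊤ else ⊥))
        (R := fun s t => if f s = t then ⊤ else ⊥) (a := s) (b := f s) (c := s)
        (s := ContinuousLinearMap.id ℂ (EuclideanSpace ℂ PUnit.{u + 1}))
        (r := ContinuousLinearMap.id ℂ (EuclideanSpace ℂ PUnit.{u + 1}))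
        (Rel.mem_dagger.2 (by rw [if_pos rfl]; trivial)) (by rw [if_pos rfl]; trivial)
      exact h
    · refine Rel.comp_le fun t s t' v hv w hw => ?_
      rw [Rel.mem_dagger] at hw
      by_cases h : f s = t'
      · by_cases h' : f s = t
        · subst h'
          subst h
          exact mem_id_of_finrank (classical_finrank _) _
        · rw [if_neg h', Submodule.mem_bot] at hw
          have hw0 : w = 0 := by
            have := congrArg ContinuousLinearMap.adjoint hw
            rwa [ContinuousLinearMap.adjoint_adjoint, map_zero] at this
          rw [hw0, ContinuousLinearMap.comp_zero]
          exact zero_mem _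
      · rw [if_neg h, Submodule.mem_bot] at hv
        rw [hv, ContinuousLinearMap.zero_comp]
        exact zero_mem _

/-- The function `! : X → 1`, with `!(a, ℂ) = L(a, ℂ)`. -/
noncomputable def toUnit (X : QSet.{u}) : X ⟶ unit where
  rel := fun _ _ => ⊤
  isFun := by
    constructor
    · refine Rel.id_le fun a => ?_
      let e := stdOrthonormalBasis ℂ (X.H a)
      let v : ∀ _, X.H a →L[ℂ] EuclideanSpace ℂ PUnit.{u + 1} := fun i =>
        (innerSL ℂ (e i)).smulRight (EuclideanSpace.single PUnit.unit (1 : ℂ))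
      have h : ContinuousLinearMap.id ℂ (X.H a) = ∑ i, (v i)† ∘L (v i) := by
        ext x
        refine ext_inner_left ℂ fun y => ?_
        rw [_root_.sum_apply, inner_sum, ContinuousLinearMap.id_apply,
          ← e.sum_inner_mul_inner y x]
        refine Finset.sum_congr rfl fun i _ => ?_
        rw [ContinuousLinearMap.comp_apply, ContinuousLinearMap.adjoint_inner_right]
        simp [v, inner_smul_left, inner_smul_right, mul_comm]
      rw [h]
      refine Submodule.sum_mem _ fun i _ => ?_
      exact Rel.comp_mem (X := X) (Y := unit) (Z := X) (b := PUnit.unit)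
        (Rel.mem_dagger.2 trivial) trivial
    · refine Rel.comp_le fun t s t' v hv w hw => ?_
      obtain rfl : t = t' := Subsingleton.elim (α := PUnit) t t'
      exact mem_id_of_finrank (unit_finrank t) (v ∘L w)

theorem toUnit_unique {X : QSet.{u}} (F : X ⟶ unit) : F = toUnit X := by
  refine Fun.ext ?_
  funext a b
  refine le_antisymm le_top ?_
  intro p _
  have h1 := F.isFun.1 a a (Rel.one_mem_id a)
  have h2 : ∀ s ∈ Rel.comp (Rel.dagger F.rel) F.rel a a, p ∘L s ∈ F.rel a b := by
    intro s hs
    induction hs using Submodule.span_induction with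
    | mem x hx =>
      obtain ⟨b', w, _, v, hv, rfl⟩ := hx
      obtain rfl : b = b' := Subsingleton.elim (α := PUnit) b b'
      have hpw := Rel.comp_mem (mem_id_of_finrank (unit_finrank b) (p ∘L w)) hv
      rwa [Rel.id_comp, ContinuousLinearMap.comp_assoc] at hpw
    | zero => simp
    | add x z _ _ hx hz => rw [ContinuousLinearMap.comp_add]; exact add_mem hx hz
    | smul k x _ hx => rw [ContinuousLinearMap.comp_smul]; exact Submodule.smul_mem _ _ hx
  simpa using h2 _ h1

/-- The quantum set `` `ℝ ``. -/
noncomputable abbrev qReal : QSet.{u} := classical (ULift.{u} ℝ)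

/-- The quantum set `` `ℂ ``. -/
noncomputable abbrev qComplex : QSet.{u} := classical (ULift.{u} ℂ)

/-- A total product `X ∗ Y`: a product of `X` and `Y` in the category of quantum sets and
functions, with its two projection functions. -/
structure TotalProduct (X Y : QSet.{u}) : Type (u + 1) where
  obj : QSet.{u}
  fst : obj ⟶ X
  snd : obj ⟶ Y
  isLimit : IsLimit (BinaryFan.mk fst snd)

namespace TotalProduct

variable {X Y : QSet.{u}} (P : TotalProduct X Y) {W W' : QSet.{u}}

/-- The function `⟨F₁, F₂⟩` into the total product. -/
noncomputable def pair (F₁ : W ⟶ X) (F₂ : W ⟶ Y) : W ⟶ P.obj :=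
  P.isLimit.lift (BinaryFan.mk F₁ F₂)

theorem pair_fst (F₁ : W ⟶ X) (F₂ : W ⟶ Y) : P.pair F₁ F₂ ≫ P.fst = F₁ :=
  P.isLimit.fac (BinaryFan.mk F₁ F₂) ⟨WalkingPair.left⟩

theorem pair_snd (F₁ : W ⟶ X) (F₂ : W ⟶ Y) : P.pair F₁ F₂ ≫ P.snd = F₂ :=
  P.isLimit.fac (BinaryFan.mk F₁ F₂) ⟨WalkingPair.right⟩

theorem comp_pair (G : W' ⟶ W) (F₁ : W ⟶ X) (F₂ : W ⟶ Y) :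
    G ≫ P.pair F₁ F₂ = P.pair (G ≫ F₁) (G ≫ F₂) := by
  refine BinaryFan.IsLimit.hom_ext P.isLimit ?_ ?_
  · exact (Category.assoc _ _ _).trans ((congrArg (G ≫ ·) (P.pair_fst F₁ F₂)).trans
      (P.pair_fst (G ≫ F₁) (G ≫ F₂)).symm)
  · exact (Category.assoc _ _ _).trans ((congrArg (G ≫ ·) (P.pair_snd F₁ F₂)).trans
      (P.pair_snd (G ≫ F₁) (G ≫ F₂)).symm)

end TotalProduct

/-- The element `r ∈ ℓ(`ℝ)` with `r(ℂ_α) = α`. -/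
noncomputable def rElt : ell qReal.{u} := fun α =>
  ((ULift.down.{u} α : ℝ) : ℂ) • ContinuousLinearMap.id ℂ (qReal.{u}.H α)

/-- The element `s = Q₁^⋆(r) + i Q₂^⋆(r)` of `ℓ(C)`, where `C` is a total product of `` `ℝ ``
with itself. -/
noncomputable def sElt (C : TotalProduct qReal.{u} qReal.{u}) : ell C.obj :=
  C.fst.pull rElt + Complex.I • C.snd.pull rElt

/-- The inclusion of `` `ℂ = `ℝ × `ℝ `` into `C`, whose components are the real part and the
imaginary part. -/
noncomputable def complexIncl (C : TotalProduct qReal.{u} qReal.{u}) : qComplex.{u} ⟶ C.obj :=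
  C.pair (classicalMap fun z => ⟨z.down.re⟩) (classicalMap fun z => ⟨z.down.im⟩)

/-- The constant function `Cst_α` from `X` to `C`, the composition of `! : X → 1`, of the
function `α : 1 → `ℂ`, and of the inclusion of `` `ℂ `` into `C`. -/
noncomputable def cst (C : TotalProduct qReal.{u} qReal.{u}) (X : QSet.{u}) (α : ℂ) :
    X ⟶ C.obj :=
  toUnit X ≫ (classicalMap fun _ : PUnit.{u + 1} => (⟨α⟩ : ULift.{u} ℂ)) ≫ complexIncl C

theorem comp_cst (C : TotalProduct qReal.{u} qReal.{u}) {X Y : QSet.{u}} (G : X ⟶ Y) (α : ℂ) :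
    G ≫ cst C Y α = cst C X α := by
  rw [cst, ← Category.assoc, toUnit_unique (G ≫ toUnit Y), cst]

/-- For functions `add, mul : C ∗ C → C` and `conj : C → C`, this says that the operations
`F₁ + F₂ = add ∘ ⟨F₁, F₂⟩`, `F₁ F₂ = mul ∘ ⟨F₁, F₂⟩`, `F^* = conj ∘ F`, with the constant functions
as scalars, make every set `Fun(X; C)` a unital `*`-algebra over `ℂ`. The multiplication by a
scalar `α` is the multiplication by `Cst_α`; in particular `0 = Cst_0` and `1 = Cst_1`. -/
structure FunStarAlgebra {C : TotalProduct qReal.{u} qReal.{u}} (P : TotalProduct C.obj C.obj)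
    (add mul : P.obj ⟶ C.obj) (conj : C.obj ⟶ C.obj) : Type (u + 1) where
  [ring : ∀ X : QSet.{u}, Ring (X ⟶ C.obj)]
  [algebra : ∀ X : QSet.{u}, Algebra ℂ (X ⟶ C.obj)]
  [starRing : ∀ X : QSet.{u}, StarRing (X ⟶ C.obj)]
  [starModule : ∀ X : QSet.{u}, StarModule ℂ (X ⟶ C.obj)]
  add_eq : ∀ (X : QSet.{u}) (F₁ F₂ : X ⟶ C.obj), F₁ + F₂ = P.pair F₁ F₂ ≫ add
  mul_eq : ∀ (X : QSet.{u}) (F₁ F₂ : X ⟶ C.obj), F₁ * F₂ = P.pair F₁ F₂ ≫ mul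
  star_eq : ∀ (X : QSet.{u}) (F : X ⟶ C.obj), star F = F ≫ conj
  algebraMap_eq : ∀ (X : QSet.{u}) (α : ℂ), algebraMap ℂ (X ⟶ C.obj) α = cst C X α

namespace FunStarAlgebra

variable {C : TotalProduct qReal.{u} qReal.{u}} {P : TotalProduct C.obj C.obj}
    {add mul : P.obj ⟶ C.obj} {conj : C.obj ⟶ C.obj} (A : FunStarAlgebra P add mul conj)

/-- The unital `*`-algebra `Fun(X; C)`. -/
noncomputable def alg (X : QSet.{u}) : StarAlgCat.{u} :=
  let _ := A.ring X
  let _ := A.algebra X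
  let _ := A.starRing X
  let _ := A.starModule X
  ⟨X ⟶ C.obj⟩

theorem comp_add {X Y : QSet.{u}} (G : Y ⟶ X) (F₁ F₂ : X ⟶ C.obj) :
    G ≫ (A.ring X).add F₁ F₂ = (A.ring Y).add (G ≫ F₁) (G ≫ F₂) := by
  refine (congrArg (G ≫ ·) (A.add_eq X F₁ F₂)).trans (Eq.trans ?_ (A.add_eq Y _ _).symm)
  exact (Category.assoc _ _ _).symm.trans (congrArg (· ≫ add) (P.comp_pair G F₁ F₂))

theorem comp_mul {X Y : QSet.{u}} (G : Y ⟶ X) (F₁ F₂ : X ⟶ C.obj) :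
    G ≫ (A.ring X).mul F₁ F₂ = (A.ring Y).mul (G ≫ F₁) (G ≫ F₂) := by
  refine (congrArg (G ≫ ·) (A.mul_eq X F₁ F₂)).trans (Eq.trans ?_ (A.mul_eq Y _ _).symm)
  exact (Category.assoc _ _ _).symm.trans (congrArg (· ≫ mul) (P.comp_pair G F₁ F₂))

theorem comp_star {X Y : QSet.{u}} (G : Y ⟶ X) (F : X ⟶ C.obj) :
    G ≫ (A.starRing X).star F = (A.starRing Y).star (G ≫ F) := by
  refine (congrArg (G ≫ ·) (A.star_eq X F)).trans (Eq.trans ?_ (A.star_eq Y _).symm)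
  exact (Category.assoc _ _ _).symm

theorem comp_algebraMap {X Y : QSet.{u}} (G : Y ⟶ X) (α : ℂ) :
    G ≫ (A.algebra X).algebraMap α = (A.algebra Y).algebraMap α := by
  refine (congrArg (G ≫ ·) (A.algebraMap_eq X α)).trans (Eq.trans ?_ (A.algebraMap_eq Y α).symm)
  exact comp_cst C G α

/-- Precomposition by `G` is a unital `*`-homomorphism. -/
noncomputable def precomp {X Y : QSet.{u}} (G : Y ⟶ X) : A.alg X ⟶ A.alg Y where
  toFun := fun F : X ⟶ C.obj => (G ≫ F : Y ⟶ C.obj)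
  map_one' := by
    have h := A.comp_algebraMap G 1
    rw [(A.algebra X).algebraMap.map_one, (A.algebra Y).algebraMap.map_one] at h
    exact h
  map_zero' := by
    have h := A.comp_algebraMap G 0
    rw [(A.algebra X).algebraMap.map_zero, (A.algebra Y).algebraMap.map_zero] at h
    exact h
  map_add' := A.comp_add G
  map_mul' := A.comp_mul G
  commutes' := A.comp_algebraMap G
  map_star' := A.comp_star G

end FunStarAlgebra

/-- The contravariant functor `Fun(−; C)`, which takes a function `G` to the precomposition
by `G`. -/
noncomputable def funFunctor {C : TotalProduct qReal.{u} qReal.{u}} {P : TotalProduct C.obj C.obj}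
    {add mul : P.obj ⟶ C.obj} {conj : C.obj ⟶ C.obj} (A : FunStarAlgebra P add mul conj) :
    QSet.{u}ᵒᵖ ⥤ StarAlgCat.{u} where
  obj X := A.alg X.unop
  map G := A.precomp G.unop
  map_id X := StarAlgHom.ext (A := (A.alg X.unop).carrier) fun F =>
    Category.id_comp (X := X.unop) (Y := C.obj) F
  map_comp {X _ _} G G' := StarAlgHom.ext (A := (A.alg X.unop).carrier) fun F =>
    Category.assoc (Z := C.obj) G'.unop G.unop F

end QuantumSets

open QuantumSets

/-! The heart is a classification: for a suitable quantum set Y with self-adjoint elements `y i` of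
ℓ(Y), the map F ↦ (F^⋆(`y i`)) is a bijection from Fun(X; Y) onto the families of self-adjoint
elements of ℓ(X). Suitable (`IsUniversal`) means that the atoms of Y carry, exactly once each up to
equivalence, the irreducible self-adjoint families of operators on nonzero finite-dimensional
spaces. The function attached to a family x in ℓ(X) is forced: it consists of all operators that
intertwine x with y. By Schur's lemma, composing this relation with its adjoint stays below the
identity of Y. Complete reducibility of self-adjoint families gives the other inequality: each space
splits into orthogonal irreducible pieces, and the projection onto each is a multiple of v†v for an
intertwiner v (`IsUniversal.exists_projection`).

There are two kinds of universal quantum sets. For one generator, `qReal` with r is universal, since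
an irreducible single self-adjoint operator is a real scalar. For any index type, `universalQSet`
takes one representative from each class of irreducible families on coordinate spaces; using only
these spaces keeps the classes a set in the right universe. Thus maps into `qReal` are single
self-adjoint elements, and `universalQSet Bool` represents pairs of them, so it is a product of
`qReal` with itself.

Splitting an element into real and imaginary parts then gives a bijection F ↦ F^⋆(s) from Fun(X; C)
onto ℓ(X) for every total product C (`funEquivEll`). All else follows from it. Two elements of ℓ(X)
amount to four self-adjoint ones, so C ∗ C exists. The operations exist uniquely because their
defining equations prescribe an element of ℓ. Since each F^⋆ is a unital *-homomorphism, the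
operations on Fun(X; C) correspond to those of ℓ(X), whose axioms transport back, and functoriality
of F ↦ F^⋆ is naturality. -/

namespace QuantumSets

/-! ### Irreducible self-adjoint families of operators and Schur's lemma -/

section Operators

set_option linter.unusedSectionVars false

variable {ι : Type} {V W : Type u}
  [NormedAddCommGroup V] [InnerProductSpace ℂ V] [FiniteDimensional ℂ V] [CompleteSpace V]
  [NormedAddCommGroup W] [InnerProductSpace ℂ W] [FiniteDimensional ℂ W] [CompleteSpace W]

/-- The subspace `K` is invariant under the operators `x i`. -/
def IsInvariant (x : ι → V →L[ℂ] V) (K : Submodule ℂ V) : Prop :=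
  ∀ i, ∀ k ∈ K, x i k ∈ K

/-- The family of operators `x` has only the trivial invariant subspaces. -/
def IsIrreducible (x : ι → V →L[ℂ] V) : Prop :=
  ∀ K, IsInvariant x K → K = ⊥ ∨ K = ⊤

/-- The operator `t` intertwines the families `x` and `y`. -/
def Intertwines (x : ι → V →L[ℂ] V) (y : ι → W →L[ℂ] W) (t : V →L[ℂ] W) : Prop :=
  ∀ i, t ∘L x i = y i ∘L t

/-- Taking adjoints reverses t x = y t and fixes the self-adjoint x and y. This is where
self-adjointness makes the category of families closed under †. -/
theorem Intertwines.adjoint {x : ι → V →L[ℂ] V} {y : ι → W →L[ℂ] W} {t : V →L[ℂ] W}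
    (hx : ∀ i, IsSelfAdjoint (x i)) (hy : ∀ i, IsSelfAdjoint (y i)) (h : Intertwines x y t) :
    Intertwines y x (t†) := by
  intro i
  have h1 := congrArg ContinuousLinearMap.adjoint (h i)
  rw [ContinuousLinearMap.adjoint_comp, ContinuousLinearMap.adjoint_comp, (hx i).adjoint_eq,
    (hy i).adjoint_eq] at h1
  exact h1.symm

theorem Intertwines.comp {U : Type u} [NormedAddCommGroup U] [InnerProductSpace ℂ U]
    {x : ι → V →L[ℂ] V} {y : ι → W →L[ℂ] W} {z : ι → U →L[ℂ] U}
    {t : W →L[ℂ] U} {s : V →L[ℂ] W} (ht : Intertwines y z t) (hs : Intertwines x y s) :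
    Intertwines x z (t ∘L s) := by
  intro i
  rw [ContinuousLinearMap.comp_assoc, hs i, ← ContinuousLinearMap.comp_assoc, ht i,
    ContinuousLinearMap.comp_assoc]

theorem Intertwines.isInvariant_ker {x : ι → V →L[ℂ] V} {y : ι → W →L[ℂ] W} {t : V →L[ℂ] W}
    (h : Intertwines x y t) : IsInvariant x (LinearMap.ker (t : V →ₗ[ℂ] W)) := by
  intro i k hk
  have hk' : t k = 0 := hk
  have h1 := congrArg (fun f => f k) (h i)
  simp only [ContinuousLinearMap.comp_apply, hk', map_zero] at h1
  exact h1

/-- A nonzero intertwiner out of an irreducible family is injective. -/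
theorem Intertwines.injective {x : ι → V →L[ℂ] V} {y : ι → W →L[ℂ] W} {t : V →L[ℂ] W}
    (hx : IsIrreducible x) (h : Intertwines x y t) (ht : t ≠ 0) : Function.Injective t := by
  rcases hx _ h.isInvariant_ker with h1 | h1
  · exact LinearMap.ker_eq_bot.1 h1
  · refine absurd ?_ ht
    ext v
    exact LinearMap.mem_ker.1 (h1 ▸ Submodule.mem_top : v ∈ LinearMap.ker (t : V →ₗ[ℂ] W))

/-- Schur's lemma: the commutant of an irreducible family consists of scalars. -/
theorem IsIrreducible.exists_eq_smul_id [Nontrivial V] {x : ι → V →L[ℂ] V}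
    (hx : IsIrreducible x) {t : V →L[ℂ] V} (h : Intertwines x x t) :
    ∃ c : ℂ, t = c • ContinuousLinearMap.id ℂ V := by
  obtain ⟨c, hc⟩ := Module.End.exists_eigenvalue (t : V →ₗ[ℂ] V)
  refine ⟨c, ?_⟩
  -- With c an eigenvalue of t, the intertwiner t − c kills an eigenvector; were it nonzero,
  -- irreducibility would make it injective.
  have h2 : Intertwines x x (t - c • ContinuousLinearMap.id ℂ V) := by
    intro i
    rw [ContinuousLinearMap.sub_comp, ContinuousLinearMap.comp_sub, h i,
      ContinuousLinearMap.smul_comp, ContinuousLinearMap.comp_smul, ContinuousLinearMap.id_comp,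
      ContinuousLinearMap.comp_id]
  obtain ⟨v, hv⟩ := hc.exists_hasEigenvector
  have hv' : t v = c • v := hv.apply_eq_smul
  by_contra hne
  refine hv.2 (h2.injective hx (sub_ne_zero.2 hne) ?_)
  simp [hv']

/-- The source of complete reducibility: ⟨k, x v⟩ = ⟨x k, v⟩ vanishes when x k stays in K. -/
theorem IsInvariant.orthogonal {x : ι → V →L[ℂ] V} (hx : ∀ i, IsSelfAdjoint (x i))
    {K : Submodule ℂ V} (hK : IsInvariant x K) : IsInvariant x Kᗮ := by
  intro i v hv
  rw [Submodule.mem_orthogonal] at hv ⊢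
  intro k hk
  rw [← (hx i).adjoint_eq, ContinuousLinearMap.adjoint_inner_right]
  exact hv _ (hK i k hk)

theorem IsInvariant.inf {x : ι → V →L[ℂ] V} {K L : Submodule ℂ V} (hK : IsInvariant x K)
    (hL : IsInvariant x L) : IsInvariant x (K ⊓ L) :=
  fun i k hk => ⟨hK i k hk.1, hL i k hk.2⟩

/-- The compression of a family of operators to a subspace. -/
noncomputable def compress (x : ι → V →L[ℂ] V) (K : Submodule ℂ V) (i : ι) : K →L[ℂ] K :=
  K.orthogonalProjectionOnto ∘L x i ∘L K.subtypeL

theorem isSelfAdjoint_compress {x : ι → V →L[ℂ] V} (hx : ∀ i, IsSelfAdjoint (x i))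
    (K : Submodule ℂ V) (i : ι) : IsSelfAdjoint (compress x K i) := by
  rw [ContinuousLinearMap.isSelfAdjoint_iff', compress, ContinuousLinearMap.adjoint_comp,
    ContinuousLinearMap.adjoint_comp, Submodule.adjoint_subtypeL,
    Submodule.adjoint_orthogonalProjectionOnto, (hx i).adjoint_eq,
    ContinuousLinearMap.comp_assoc]

theorem IsInvariant.intertwines_subtypeL {x : ι → V →L[ℂ] V} {K : Submodule ℂ V}
    (hK : IsInvariant x K) : Intertwines (compress x K) x K.subtypeL := by
  intro i
  ext k
  simp only [ContinuousLinearMap.comp_apply, compress, Submodule.subtypeL_apply]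
  exact Submodule.starProjection_eq_self_iff.2 (hK i k k.2)

/-- A self-adjoint family compressed to an invariant subspace without smaller nonzero invariant
subspaces is irreducible. -/
theorem IsInvariant.isIrreducible_compress {x : ι → V →L[ℂ] V} {K : Submodule ℂ V}
    (hK : IsInvariant x K) (h : ∀ L ≤ K, IsInvariant x L → L = ⊥ ∨ L = K) :
    IsIrreducible (compress x K) := by
  intro L hL
  -- On an invariant K the compression is just the restriction, so its invariant subspaces are those
  -- of x contained in K.
  have hinv : IsInvariant x (L.map K.subtype) := by
    rintro i _ ⟨l, hl, rfl⟩
    refine ⟨compress x K i l, hL i l hl, ?_⟩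
    exact congrArg (fun f => f l) (hK.intertwines_subtypeL i)
  rcases h _ (Submodule.map_subtype_le K L) hinv with h1 | h1
  · left
    exact Submodule.map_injective_of_injective K.injective_subtype (by rw [h1, Submodule.map_bot])
  · right
    refine (Submodule.eq_top_iff' ).2 fun k => ?_
    obtain ⟨l, hl, hlk⟩ : (k : V) ∈ L.map K.subtype := h1.symm ▸ k.2
    rwa [← Subtype.ext hlk]

/-- A self-adjoint scalar multiple of the identity is a real multiple. -/
theorem exists_real_of_isSelfAdjoint [Nontrivial V] {x : V →L[ℂ] V} (hx : IsSelfAdjoint x)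
    {c : ℂ} (h : x = c • ContinuousLinearMap.id ℂ V) :
    ∃ r : ℝ, x = (r : ℂ) • ContinuousLinearMap.id ℂ V := by
  have h1 := hx.adjoint_eq
  rw [h, map_smulₛₗ, ContinuousLinearMap.adjoint_id] at h1
  obtain ⟨v, hv⟩ := exists_ne (0 : V)
  have h2 := congrArg (fun f => f v) h1
  simp only [_root_.smul_apply, ContinuousLinearMap.id_apply] at h2
  obtain ⟨r, hr⟩ := Complex.conj_eq_iff_real.1 (smul_left_injective ℂ hv h2)
  exact ⟨r, hr ▸ h⟩

theorem adjoint_comp_self_ne_zero {t : V →L[ℂ] W} (ht : t ≠ 0) : t† ∘L t ≠ 0 := by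
  intro h
  apply ht
  ext v
  have h1 := congrArg (fun f => inner ℂ v (f v)) h
  simp only [ContinuousLinearMap.comp_apply, ContinuousLinearMap.adjoint_inner_right] at h1
  simpa using h1

end Operators

/-! ### Universal quantum sets and the classification of functions into them -/

/-- The self-adjoint elements `y i` of `ℓ(Y)` present the atoms of `Y` as a complete system of
representatives of the irreducible self-adjoint families: the operators between two atoms that
intertwine the `y i` are in the identity relation, and every irreducible self-adjoint family has a
nonzero intertwiner to some atom. -/
structure IsUniversal {ι : Type} (Y : QSet.{u}) (y : ι → ell Y) : Prop where
  isSelfAdjoint : ∀ i b, IsSelfAdjoint (y i b)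
  mem_id : ∀ b b' (t : Y.H b →L[ℂ] Y.H b'),
    Intertwines (fun i => y i b) (fun i => y i b') t → t ∈ Rel.id Y b b'
  exists_intertwines : ∀ (V : Type u) [NormedAddCommGroup V] [InnerProductSpace ℂ V]
    [FiniteDimensional ℂ V] [CompleteSpace V] [Nontrivial V] (x : ι → V →L[ℂ] V),
    (∀ i, IsSelfAdjoint (x i)) → IsIrreducible x →
      ∃ b, ∃ v : V →L[ℂ] Y.H b, v ≠ 0 ∧ Intertwines x (fun i => y i b) v

section Classify

variable {ι : Type} {X Y : QSet.{u}} {y : ι → ell Y} {x : ι → ell X}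

/-- The relation consisting of all operators that intertwine `x` and `y`. -/
def intertwinerRel (x : ι → ell X) (y : ι → ell Y) : Rel X Y := fun a b =>
  { carrier := {v | Intertwines (fun i => x i a) (fun i => y i b) v}
    zero_mem' := fun i => by simp
    add_mem' := fun {v w} hv hw i => by
      rw [ContinuousLinearMap.add_comp, ContinuousLinearMap.comp_add, hv i, hw i]
    smul_mem' := fun c v hv i => by
      rw [ContinuousLinearMap.smul_comp, ContinuousLinearMap.comp_smul, hv i] }

/-- Complete reducibility, by strong induction on dim K: the p obtained is the orthogonal projection
onto K. The case of K the whole atom puts the identity in the composite relation, which is the first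
axiom of a function. -/
theorem IsUniversal.exists_projection (hy : IsUniversal Y y)
    (hx : ∀ i a, IsSelfAdjoint (x i a)) (a : X.At) (n : ℕ) :
    ∀ K : Submodule ℂ (X.H a), Module.finrank ℂ K = n → IsInvariant (fun i => x i a) K →
      ∃ p ∈ Rel.comp (Rel.dagger (intertwinerRel x y)) (intertwinerRel x y) a a,
        (∀ k ∈ K, p k = k) ∧ ∀ k ∈ Kᗮ, p k = 0 := by
  induction n using Nat.strong_induction_on with
  | _ n ih =>
  rintro K rfl hK
  by_cases hK0 : K = ⊥
  · subst hK0
    exact ⟨0, zero_mem _, by simp, by simp⟩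
  by_cases hirr : ∀ L ≤ K, IsInvariant (fun i => x i a) L → L = ⊥ ∨ L = K
  · have : Nontrivial K := Submodule.nontrivial_iff_ne_bot.2 hK0
    have hxK := isSelfAdjoint_compress (fun i => hx i a) K
    have hirr' := hK.isIrreducible_compress hirr
    obtain ⟨b, v, hv0, hv⟩ := hy.exists_intertwines K _ hxK hirr'
    -- On a minimal K, v†v commutes with the irreducible compressed family, so it is a scalar c.
    -- With P the projection onto K, (vP)†(vP) = cP, and c ≠ 0 since v ≠ 0.
    obtain ⟨c, hc⟩ := hirr'.exists_eq_smul_id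
      ((hv.adjoint hxK fun i => hy.isSelfAdjoint i b).comp hv)
    have hc0 : c ≠ 0 := by
      rintro rfl
      exact adjoint_comp_self_ne_zero hv0 (by rw [hc, zero_smul])
    have hproj := hK.intertwines_subtypeL.adjoint hxK fun i => hx i a
    rw [Submodule.adjoint_subtypeL] at hproj
    have hmem : v ∘L K.orthogonalProjectionOnto ∈ intertwinerRel x y a b := hv.comp hproj
    refine ⟨c⁻¹ • ((v ∘L K.orthogonalProjectionOnto)† ∘L (v ∘L K.orthogonalProjectionOnto)),
      Submodule.smul_mem _ _ (Rel.comp_mem (b := b) (Rel.mem_dagger.2 ?_) hmem), ?_, ?_⟩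
    · rwa [ContinuousLinearMap.adjoint_adjoint]
    · intro k hk
      rw [ContinuousLinearMap.adjoint_comp, ContinuousLinearMap.comp_assoc,
        ← ContinuousLinearMap.comp_assoc _ v, hc, Submodule.adjoint_orthogonalProjectionOnto]
      simp only [_root_.smul_apply, ContinuousLinearMap.comp_apply,
        ContinuousLinearMap.id_apply, map_smul, smul_smul, inv_mul_cancel₀ hc0, one_smul]
      exact Submodule.starProjection_eq_self_iff.2 hk
    · intro k hk
      simp only [_root_.smul_apply, ContinuousLinearMap.comp_apply,
        Submodule.orthogonalProjectionOnto_apply_of_mem_orthogonal hk, map_zero, smul_zero]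
  · push Not at hirr
    obtain ⟨L, hLK, hL, hL0, hne⟩ := hirr
    -- K is the orthogonal sum of L and Lᗮ ⊓ K, both of smaller dimension, so the projection onto K
    -- is the sum of the two given by induction.
    have hM : IsInvariant (fun i => x i a) (Lᗮ ⊓ K) := (hL.orthogonal fun i => hx i a).inf hK
    have hrank := Submodule.finrank_add_inf_finrank_orthogonal hLK
    have hLpos : 0 < Module.finrank ℂ L := by
      have : Nontrivial L := Submodule.nontrivial_iff_ne_bot.2 hL0
      exact Module.finrank_pos
    obtain ⟨p, hp, hp1, hp2⟩ := ih _ (Submodule.finrank_lt_finrank_of_lt (lt_of_le_of_ne hLK hne))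
      L rfl hL
    obtain ⟨q, hq, hq1, hq2⟩ := ih _ (by omega) (Lᗮ ⊓ K) rfl hM
    refine ⟨p + q, add_mem hp hq, ?_, ?_⟩
    · intro k hk
      rw [← Submodule.sup_orthogonal_inf_of_hasOrthogonalProjection hLK] at hk
      obtain ⟨l, hl, m, hm, rfl⟩ := Submodule.mem_sup.1 hk
      have hl' : l ∈ (Lᗮ ⊓ K)ᗮ :=
        Submodule.orthogonal_le inf_le_left (Submodule.le_orthogonal_orthogonal L hl)
      rw [_root_.add_apply, map_add, map_add, hp1 l hl, hp2 m hm.1, hq2 l hl', hq1 m hm]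
      simp
    · intro k hk
      rw [_root_.add_apply, hp2 k (Submodule.orthogonal_le hLK hk),
        hq2 k (Submodule.orthogonal_le inf_le_right hk), add_zero]

/-- The first axiom is `exists_projection` for the whole atom. For the second, v w with w† and v
intertwiners out of the same atom intertwines y with itself, so `mem_id` applies. -/
theorem IsUniversal.isFun_intertwinerRel (hy : IsUniversal Y y)
    (hx : ∀ i a, IsSelfAdjoint (x i a)) : (intertwinerRel x y).IsFun := by
  constructor
  · refine Rel.id_le fun a => ?_
    obtain ⟨p, hp, hp1, -⟩ := hy.exists_projection hx a _ ⊤ rfl fun _ _ _ => trivial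
    convert hp
    ext v
    exact (hp1 v trivial).symm
  · refine Rel.comp_le fun b a b' v hv w hw => hy.mem_id b b' _ ?_
    have hw' : Intertwines (fun i => x i a) (fun i => y i b) (w†) := Rel.mem_dagger.1 hw
    have h := hw'.adjoint (fun i => hx i a) fun i => hy.isSelfAdjoint i b
    rw [ContinuousLinearMap.adjoint_adjoint] at h
    exact Intertwines.comp hv h

/-- A function into a universal quantum set consists of all intertwiners. -/
theorem IsUniversal.rel_eq (hy : IsUniversal Y y) (hx : ∀ i a, IsSelfAdjoint (x i a))
    (F : Fun X Y) (hF : ∀ i, F.pull (y i) = x i) : F.rel = intertwinerRel x y := by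
  have hle : F.rel ≤ intertwinerRel x y := by
    intro a b v hv i
    have h := F.comp_pullFun (y i) hv
    rwa [show F.pullFun (y i) = x i from hF i] at h
  refine le_antisymm hle fun a b v hv => ?_
  -- The identity lies in F† ∘ F, so v is a combination of products v w t with w† and t in F. Here v
  -- w intertwines y with itself, hence is in the identity relation, and v w t stays in F.
  have h1 := F.isFun.1 a a (Rel.one_mem_id a)
  have h2 : ∀ s ∈ Rel.comp (Rel.dagger F.rel) F.rel a a, v ∘L s ∈ F.rel a b := by
    intro s hs
    induction hs using Submodule.span_induction with
    | mem s hs =>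
      obtain ⟨c, w, hw, t, ht, rfl⟩ := hs
      have hw' : Intertwines (fun i => x i a) (fun i => y i c) (w†) :=
        hle a c (Rel.mem_dagger.1 hw)
      have h := hw'.adjoint (fun i => hx i a) fun i => hy.isSelfAdjoint i c
      rw [ContinuousLinearMap.adjoint_adjoint] at h
      have h3 := Rel.comp_mem (hy.mem_id c b _ (Intertwines.comp hv h)) ht
      rwa [Rel.id_comp, ContinuousLinearMap.comp_assoc] at h3
    | zero => simp
    | add s t _ _ hs ht => rw [ContinuousLinearMap.comp_add]; exact add_mem hs ht
    | smul k s _ hs => rw [ContinuousLinearMap.comp_smul]; exact Submodule.smul_mem _ _ hs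
  simpa using h2 _ h1

/-- Functions into a universal quantum set correspond to self-adjoint families. -/
theorem IsUniversal.existsUnique (hy : IsUniversal Y y) (hx : ∀ i, IsSelfAdjoint (x i)) :
    ∃! F : X ⟶ Y, ∀ i, Fun.pull F (y i) = x i := by
  have hx' : ∀ i a, IsSelfAdjoint (x i a) := fun i a => congrFun (hx i) a
  refine ⟨⟨intertwinerRel x y, hy.isFun_intertwinerRel hx'⟩, fun i => ?_, fun F hF => ?_⟩
  · exact Fun.pullFun_eq _ fun a b v hv => hv i
  · exact Fun.ext (hy.rel_eq hx' F hF)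

end Classify

/-! ### Examples of universal quantum sets -/

theorem isUniversal_rElt : IsUniversal qReal.{u} (fun _ : Unit => rElt) where
  isSelfAdjoint _ b := by
    rw [ContinuousLinearMap.isSelfAdjoint_iff', rElt, map_smulₛₗ, ContinuousLinearMap.adjoint_id,
      Complex.conj_ofReal]
  mem_id b b' t ht := by
    have h := ht ()
    simp only [rElt, ContinuousLinearMap.comp_smul, ContinuousLinearMap.smul_comp] at h
    change (_ : ℂ) • t = (_ : ℂ) • t at h
    by_cases h0 : t = 0
    · rw [h0]
      exact zero_mem _
    · obtain rfl : b = b' := ULift.ext _ _ (Complex.ofReal_injective (smul_left_injective ℂ h0 h))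
      exact mem_id_of_finrank (classical_finrank _) t
  exists_intertwines V _ _ _ _ _ x hx hirr := by
    -- A single operator commutes with itself, so an irreducible one is a scalar, and a real one by
    -- self-adjointness. Any nonzero functional then intertwines it with r at the corresponding
    -- atom.
    obtain ⟨c, hc⟩ := hirr.exists_eq_smul_id (t := x ()) fun _ => rfl
    obtain ⟨r, hr⟩ := exists_real_of_isSelfAdjoint (hx ()) hc
    obtain ⟨e, he⟩ := exists_ne (0 : V)
    refine ⟨⟨r⟩, (innerSL ℂ e).smulRight (EuclideanSpace.single PUnit.unit (1 : ℂ)), ?_, ?_⟩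
    · intro h
      have h1 := congrArg (fun f => f e PUnit.unit) h
      simp at h1
      exact he h1
    · intro i
      simp only [rElt]
      rw [hr, ContinuousLinearMap.comp_smul, ContinuousLinearMap.smul_comp]
      rfl

/-- An irreducible family of self-adjoint operators on a nonzero space `ℂⁿ`. -/
structure IrreducibleFamily (ι : Type) : Type u where
  n : ℕ
  nontrivial : Nontrivial (EuclideanSpace ℂ (ULift.{u} (Fin n)))
  op : ι → EuclideanSpace ℂ (ULift.{u} (Fin n)) →L[ℂ] EuclideanSpace ℂ (ULift.{u} (Fin n))
  isSelfAdjoint : ∀ i, IsSelfAdjoint (op i)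
  isIrreducible : IsIrreducible op

/-- Symmetry comes from adjoints; transitivity holds because a nonzero intertwiner out of an
irreducible family is injective, so composites remain nonzero. -/
instance IrreducibleFamily.setoid (ι : Type) : Setoid (IrreducibleFamily.{u} ι) where
  r x y := ∃ t, t ≠ 0 ∧ Intertwines x.op y.op t
  iseqv :=
    { refl := fun x => by
        have := x.nontrivial
        refine ⟨ContinuousLinearMap.id ℂ _, fun h => ?_, fun i => rfl⟩
        obtain ⟨v, hv⟩ := exists_ne (0 : EuclideanSpace ℂ (ULift.{u} (Fin x.n)))
        exact hv (congrArg (fun f => f v) h)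
      symm := fun {x y} ⟨t, ht, h⟩ =>
        ⟨t†, fun h0 => ht ((map_eq_zero_iff _ (LinearIsometryEquiv.injective _)).1 h0),
          h.adjoint x.isSelfAdjoint y.isSelfAdjoint⟩
      trans := fun {x y z} ⟨t, ht, h⟩ ⟨s, hs, h'⟩ => by
        refine ⟨s ∘L t, fun h0 => ht ?_, h'.comp h⟩
        ext1 v
        refine h'.injective y.isIrreducible hs ?_
        rw [← ContinuousLinearMap.comp_apply, h0]
        simp }

/-- The quantum set whose atoms carry the irreducible self-adjoint families indexed by `ι`, one
for each equivalence class. -/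
noncomputable abbrev universalQSet (ι : Type) : QSet.{u} where
  At := Quotient (IrreducibleFamily.setoid.{u} ι)
  H q := EuclideanSpace ℂ (ULift.{u} (Fin q.out.n))
  nontriv q := q.out.nontrivial

/-- The generators of `ℓ(universalQSet ι)`. -/
noncomputable def universalElt (ι : Type) (i : ι) : ell (universalQSet.{u} ι) := fun q =>
  (Quotient.out q).op i

/-- A nonzero intertwiner between representatives forces equal classes, and Schur's lemma then makes
it a scalar. An abstract irreducible family reaches its representative after being moved to
coordinates by an orthonormal basis. -/
theorem isUniversal_universalElt (ι : Type) :
    IsUniversal (universalQSet.{u} ι) (universalElt ι) where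
  isSelfAdjoint i q := (Quotient.out q).isSelfAdjoint i
  mem_id q q' t ht := by
    by_cases h0 : t = 0
    · rw [h0]
      exact zero_mem _
    · obtain rfl : q = q' := Quotient.out_equiv_out.1 ⟨t, h0, ht⟩
      have := (Quotient.out q).nontrivial
      obtain ⟨c, hc⟩ := IsIrreducible.exists_eq_smul_id (V := (universalQSet.{u} ι).H q)
        (Quotient.out q).isIrreducible ht
      rw [hc]
      exact Submodule.smul_mem _ _ (Rel.one_mem_id q)
  exists_intertwines V _ _ _ _ _ x hx hirr := by
    let φ : V ≃ₗᵢ[ℂ] EuclideanSpace ℂ (ULift.{u} (Fin (Module.finrank ℂ V))) :=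
      ((stdOrthonormalBasis ℂ V).reindex Equiv.ulift.symm).repr
    let f : V →L[ℂ] EuclideanSpace ℂ (ULift.{u} (Fin (Module.finrank ℂ V))) := φ
    let g : EuclideanSpace ℂ (ULift.{u} (Fin (Module.finrank ℂ V))) →L[ℂ] V := φ.symm
    have hg : f† = g := ContinuousLinearMap.ext fun v => by
      refine ext_inner_left ℂ fun w => ?_
      rw [ContinuousLinearMap.adjoint_inner_right]
      exact φ.inner_map_eq_flip w v
    have hf : g† = f := by rw [← hg, ContinuousLinearMap.adjoint_adjoint]
    have hgf : ∀ v, g (f v) = v := φ.symm_apply_apply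
    have hfg : ∀ v, f (g v) = v := φ.apply_symm_apply
    let z : IrreducibleFamily.{u} ι :=
      { n := Module.finrank ℂ V
        nontrivial := φ.symm.toEquiv.nontrivial
        op := fun i => f ∘L x i ∘L g
        isSelfAdjoint := fun i => by
          rw [ContinuousLinearMap.isSelfAdjoint_iff', ContinuousLinearMap.adjoint_comp,
            ContinuousLinearMap.adjoint_comp, (hx i).adjoint_eq, hf, hg,
            ContinuousLinearMap.comp_assoc]
        isIrreducible := fun K hK => by
          have hinv : IsInvariant x (K.comap (f : V →ₗ[ℂ] _)) := by
            intro i k hk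
            have := hK i _ hk
            simpa [hgf] using this
          have hmap : ∀ v, v ∈ K ↔ g v ∈ K.comap (f : V →ₗ[ℂ] _) := fun v => by simp [hfg]
          rcases hirr _ hinv with h | h
          · left
            refine (Submodule.eq_bot_iff _).2 fun v hv => ?_
            rw [hmap, h, Submodule.mem_bot] at hv
            rw [← hfg v, hv, map_zero]
          · right
            refine (Submodule.eq_top_iff').2 fun v => ?_
            rw [hmap, h]
            trivial }
    obtain ⟨t, ht, h⟩ : z ≈ (Quotient.mk _ z).out := Setoid.symm (Quotient.mk_out z)
    refine ⟨Quotient.mk _ z, t ∘L f, fun h0 => ht ?_, h.comp fun i => ?_⟩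
    · ext1 v
      rw [← hfg v]
      exact congrArg (fun s => s (g v)) h0
    · ext1 v
      simp [z, hgf]

/-! ### Functions into `C` as elements of ℓ -/

open scoped ComplexStarModule

/-- The self-adjoint parts of an element of a `*`-vector space are unique. -/
theorem eq_and_eq_of_add_I_smul_eq {A : Type*} [AddCommGroup A] [Module ℂ A] [StarAddMonoid A]
    [StarModule ℂ A] {a b a' b' : A} (ha : IsSelfAdjoint a) (hb : IsSelfAdjoint b)
    (ha' : IsSelfAdjoint a') (hb' : IsSelfAdjoint b')
    (h : a + Complex.I • b = a' + Complex.I • b') : a = a' ∧ b = b' := by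
  have key : ∀ {a b : A}, IsSelfAdjoint a → IsSelfAdjoint b →
      (ℜ (a + Complex.I • b) : A) = a ∧ (ℑ (a + Complex.I • b) : A) = b := by
    intro a b ha hb
    rw [map_add, map_add, realPart_I_smul, imaginaryPart_I_smul, ha.imaginaryPart,
      hb.imaginaryPart, neg_zero, add_zero, zero_add, ha.coe_realPart, hb.coe_realPart]
    exact ⟨rfl, rfl⟩
  exact ⟨(key ha hb).1.symm.trans (h ▸ (key ha' hb').1),
    (key ha hb).2.symm.trans (h ▸ (key ha' hb').2)⟩

theorem pull_comp_apply {X Y Z : QSet.{u}} (F : X ⟶ Y) (G : Y ⟶ Z) (z : ell Z) :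
    Fun.pull (F ≫ G) z = Fun.pull F (Fun.pull G z) :=
  congrArg (fun f : ell Z →⋆ₐ[ℂ] ell X => f z) (Fun.pull_comp F G)

theorem isSelfAdjoint_rElt : IsSelfAdjoint rElt.{u} :=
  funext (isUniversal_rElt.isSelfAdjoint ())

theorem existsUnique_pull_rElt {X : QSet.{u}} {x : ell X} (hx : IsSelfAdjoint x) :
    ∃! F : X ⟶ qReal.{u}, Fun.pull F rElt = x := by
  obtain ⟨F, hF, huniq⟩ := isUniversal_rElt.existsUnique (x := fun _ : Unit => x) fun _ => hx
  exact ⟨F, hF (), fun G hG => huniq G fun _ => hG⟩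

theorem eq_of_pull_rElt_eq {X : QSet.{u}} {F G : X ⟶ qReal.{u}}
    (h : Fun.pull F rElt = Fun.pull G rElt) : F = G :=
  (existsUnique_pull_rElt (isSelfAdjoint_rElt.map (Fun.pull G))).unique h rfl

theorem pull_sElt (C : TotalProduct qReal.{u} qReal.{u}) {X : QSet.{u}} (F : X ⟶ C.obj) :
    Fun.pull F (sElt C) =
      Fun.pull (F ≫ C.fst) rElt + Complex.I • Fun.pull (F ≫ C.snd) rElt := by
  rw [sElt, map_add, map_smul, pull_comp_apply, pull_comp_apply]

/-- A function into `` `ℝ ∗ `ℝ `` is determined by the image of `s`. -/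
theorem pull_sElt_injective (C : TotalProduct qReal.{u} qReal.{u}) (X : QSet.{u}) :
    Function.Injective fun F : X ⟶ C.obj => Fun.pull F (sElt C) := by
  intro F G h
  simp only [pull_sElt] at h
  obtain ⟨h1, h2⟩ := eq_and_eq_of_add_I_smul_eq (isSelfAdjoint_rElt.map _)
    (isSelfAdjoint_rElt.map _) (isSelfAdjoint_rElt.map _) (isSelfAdjoint_rElt.map _) h
  exact BinaryFan.IsLimit.hom_ext C.isLimit (eq_of_pull_rElt_eq h1) (eq_of_pull_rElt_eq h2)

/-- Every element of `ℓ(X)` is the image of `s` under a function into `` `ℝ ∗ `ℝ ``. -/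
theorem pull_sElt_surjective (C : TotalProduct qReal.{u} qReal.{u}) (X : QSet.{u}) :
    Function.Surjective fun F : X ⟶ C.obj => Fun.pull F (sElt C) := by
  intro x
  obtain ⟨F₁, h₁, -⟩ := existsUnique_pull_rElt (ℜ x).2
  obtain ⟨F₂, h₂, -⟩ := existsUnique_pull_rElt (ℑ x).2
  refine ⟨C.pair F₁ F₂, ?_⟩
  simp only [pull_sElt]
  rw [C.pair_fst, C.pair_snd, h₁, h₂]
  exact realPart_add_I_smul_imaginaryPart x

/-- Functions into `` `ℝ ∗ `ℝ `` correspond to elements of `ℓ(X)`. -/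
noncomputable def funEquivEll (C : TotalProduct qReal.{u} qReal.{u}) (X : QSet.{u}) :
    (X ⟶ C.obj) ≃ ell X :=
  Equiv.ofBijective _ ⟨pull_sElt_injective C X, pull_sElt_surjective C X⟩

theorem funEquivEll_apply (C : TotalProduct qReal.{u} qReal.{u}) {X : QSet.{u}} (F : X ⟶ C.obj) :
    funEquivEll C X F = Fun.pull F (sElt C) :=
  rfl

theorem existsUnique_pull_sElt (C : TotalProduct qReal.{u} qReal.{u}) {X : QSet.{u}} (x : ell X) :
    ∃! F : X ⟶ C.obj, Fun.pull F (sElt C) = x :=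
  (funEquivEll C X).bijective.existsUnique x

/-! ### Existence of the total products -/

theorem isSelfAdjoint_universalElt {ι : Type} (i : ι) :
    IsSelfAdjoint (universalElt.{u} ι i) :=
  funext ((isUniversal_universalElt ι).isSelfAdjoint i)

/-- A pair of functions into `qReal` is a pair of self-adjoint elements, hence one function into
`universalQSet Bool`; the projections are the functions named by its two generators. -/
theorem nonempty_totalProduct_qReal : Nonempty (TotalProduct qReal.{u} qReal.{u}) := by
  obtain ⟨Q₁, hQ₁, -⟩ := existsUnique_pull_rElt (isSelfAdjoint_universalElt.{u} false)
  obtain ⟨Q₂, hQ₂, -⟩ := existsUnique_pull_rElt (isSelfAdjoint_universalElt.{u} true)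
  have hlift : ∀ {W : QSet.{u}} (F₁ F₂ : W ⟶ qReal.{u}), ∃! F : W ⟶ universalQSet.{u} Bool,
      F ≫ Q₁ = F₁ ∧ F ≫ Q₂ = F₂ := by
    intro W F₁ F₂
    obtain ⟨F, hF, huniq⟩ := (isUniversal_universalElt.{u} Bool).existsUnique
      (x := fun i => Fun.pull (bif i then F₂ else F₁) rElt) fun i => isSelfAdjoint_rElt.map _
    refine ⟨F, ⟨?_, ?_⟩, ?_⟩
    · exact eq_of_pull_rElt_eq (by rw [pull_comp_apply, hQ₁]; exact hF false)
    · exact eq_of_pull_rElt_eq (by rw [pull_comp_apply, hQ₂]; exact hF true)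
    · rintro G ⟨rfl, rfl⟩
      refine huniq G fun i => ?_
      cases i
      · rw [cond_false, pull_comp_apply, hQ₁]
      · rw [cond_true, pull_comp_apply, hQ₂]
  choose lift hl huniq using @hlift
  exact ⟨⟨universalQSet Bool, Q₁, Q₂, BinaryFan.IsLimit.mk _ (fun f g => lift f g)
    (fun f g => (hl f g).1) (fun f g => (hl f g).2) fun f g m h1 h2 => huniq f g m ⟨h1, h2⟩⟩⟩

theorem nonempty_totalProduct_obj (C : TotalProduct qReal.{u} qReal.{u}) :
    Nonempty (TotalProduct C.obj C.obj) := by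
  -- The index j selects the factor, and k the real (`false`) or imaginary (`true`) part of the
  -- corresponding element of ℓ.
  let y : Bool → Bool → ell (universalQSet.{u} (Bool × Bool)) := fun j k => universalElt _ (j, k)
  have hy : ∀ j k, IsSelfAdjoint (y j k) := fun j k => isSelfAdjoint_universalElt _
  obtain ⟨Q₁, hQ₁, -⟩ := existsUnique_pull_sElt C (y false false + Complex.I • y false true)
  obtain ⟨Q₂, hQ₂, -⟩ := existsUnique_pull_sElt C (y true false + Complex.I • y true true)
  have hlift : ∀ {W : QSet.{u}} (F₁ F₂ : W ⟶ C.obj),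
      ∃! F : W ⟶ universalQSet.{u} (Bool × Bool), F ≫ Q₁ = F₁ ∧ F ≫ Q₂ = F₂ := by
    intro W F₁ F₂
    let G : Bool × Bool → (W ⟶ qReal.{u}) := fun p =>
      (bif p.1 then F₂ else F₁) ≫ (bif p.2 then C.snd else C.fst)
    obtain ⟨F, hF, huniq⟩ := (isUniversal_universalElt.{u} (Bool × Bool)).existsUnique
      (x := fun p => Fun.pull (G p) rElt) fun p => isSelfAdjoint_rElt.map _
    refine ⟨F, ⟨?_, ?_⟩, ?_⟩
    · refine pull_sElt_injective C W ?_
      change Fun.pull (F ≫ Q₁) (sElt C) = Fun.pull F₁ (sElt C)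
      rw [pull_comp_apply, hQ₁, map_add, map_smul, hF, hF, pull_sElt]
      rfl
    · refine pull_sElt_injective C W ?_
      change Fun.pull (F ≫ Q₂) (sElt C) = Fun.pull F₂ (sElt C)
      rw [pull_comp_apply, hQ₂, map_add, map_smul, hF, hF, pull_sElt]
      rfl
    · rintro F' ⟨h₁, h₂⟩
      have e₁ := congrArg (fun F => Fun.pull F (sElt C)) h₁
      have e₂ := congrArg (fun F => Fun.pull F (sElt C)) h₂
      simp only [pull_comp_apply F', hQ₁, hQ₂, map_add, map_smul, pull_sElt] at e₁ e₂
      have e₁' := eq_and_eq_of_add_I_smul_eq ((hy _ _).map _) ((hy _ _).map _)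
        (isSelfAdjoint_rElt.map _) (isSelfAdjoint_rElt.map _) e₁
      have e₂' := eq_and_eq_of_add_I_smul_eq ((hy _ _).map _) ((hy _ _).map _)
        (isSelfAdjoint_rElt.map _) (isSelfAdjoint_rElt.map _) e₂
      refine huniq F' fun p => ?_
      obtain ⟨_ | _, _ | _⟩ := p
      exacts [e₁'.1, e₁'.2, e₂'.1, e₂'.2]
  choose lift hl huniq using @hlift
  exact ⟨⟨universalQSet (Bool × Bool), Q₁, Q₂, BinaryFan.IsLimit.mk _ (fun f g => lift f g)
    (fun f g => (hl f g).1) (fun f g => (hl f g).2) fun f g m h1 h2 => huniq f g m ⟨h1, h2⟩⟩⟩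

/-! ### Constant functions -/

/-- The pullback of `r` along the function of an ordinary function. -/
theorem pull_classicalMap_rElt {S : Type u} (f : S → ULift.{u} ℝ) :
    Fun.pull (classicalMap f) rElt =
      fun s => ((f s).down : ℂ) • ContinuousLinearMap.id ℂ ((classical S).H s) := by
  refine Fun.pullFun_eq _ fun s t v hv => ?_
  simp only [classicalMap] at hv
  split_ifs at hv with h
  · subst h
    rw [rElt, ContinuousLinearMap.comp_smul, ContinuousLinearMap.smul_comp]
    rfl
  · rw [(Submodule.mem_bot ℂ).1 hv]
    simp

theorem pull_complexIncl (C : TotalProduct qReal.{u} qReal.{u}) :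
    Fun.pull (complexIncl C) (sElt C) =
      fun z => (ULift.down.{u} z : ℂ) • ContinuousLinearMap.id ℂ (qComplex.{u}.H z) := by
  rw [pull_sElt, complexIncl, C.pair_fst, C.pair_snd, pull_classicalMap_rElt,
    pull_classicalMap_rElt]
  funext z
  rw [Pi.add_apply, Pi.smul_apply, smul_smul]
  refine (add_smul _ _ (ContinuousLinearMap.id ℂ (qComplex.{u}.H z))).symm.trans ?_
  rw [mul_comm, Complex.re_add_im]

/-- On `qComplex` the element s becomes z ↦ z, which the point α evaluates to the scalar α; unital
algebra homomorphisms preserve scalars. -/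
theorem pull_cst (C : TotalProduct qReal.{u} qReal.{u}) (X : QSet.{u}) (α : ℂ) :
    Fun.pull (cst C X α) (sElt C) = algebraMap ℂ (ell X) α := by
  rw [cst, pull_comp_apply, pull_comp_apply, pull_complexIncl]
  have h : Fun.pull (classicalMap fun _ : PUnit.{u + 1} => (⟨α⟩ : ULift.{u} ℂ))
      (fun z => (ULift.down.{u} z : ℂ) • ContinuousLinearMap.id ℂ (qComplex.{u}.H z)) =
        algebraMap ℂ (ell unit.{u}) α := by
    refine Fun.pullFun_eq _ fun s t v hv => ?_
    simp only [classicalMap] at hv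
    split_ifs at hv with h
    · subst h
      rw [ContinuousLinearMap.smul_comp, Pi.algebraMap_apply, Algebra.algebraMap_eq_smul_one,
        ContinuousLinearMap.comp_smul]
      rfl
    · rw [(Submodule.mem_bot ℂ).1 hv]
      simp
  rw [h]
  exact AlgHomClass.commutes _ α

/-! ### The *-algebra structure on Fun(X; C) and its comparison with ℓ(X) -/

section StarAlgebra

variable {C : TotalProduct qReal.{u} qReal.{u}} {P : TotalProduct C.obj C.obj}
    {add mul : P.obj ⟶ C.obj} {conj : C.obj ⟶ C.obj}

theorem pull_pair_add
    (hadd : Fun.pull add (sElt C) = Fun.pull P.fst (sElt C) + Fun.pull P.snd (sElt C))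
    {X : QSet.{u}} (F G : X ⟶ C.obj) :
    Fun.pull (P.pair F G ≫ add) (sElt C) = Fun.pull F (sElt C) + Fun.pull G (sElt C) := by
  rw [pull_comp_apply, hadd, map_add, ← pull_comp_apply, ← pull_comp_apply, P.pair_fst,
    P.pair_snd]

theorem pull_pair_mul
    (hmul : Fun.pull mul (sElt C) = Fun.pull P.fst (sElt C) * Fun.pull P.snd (sElt C))
    {X : QSet.{u}} (F G : X ⟶ C.obj) :
    Fun.pull (P.pair F G ≫ mul) (sElt C) = Fun.pull F (sElt C) * Fun.pull G (sElt C) := by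
  rw [pull_comp_apply, hmul, map_mul, ← pull_comp_apply, ← pull_comp_apply, P.pair_fst,
    P.pair_snd]

theorem pull_comp_conj (hconj : Fun.pull conj (sElt C) = star (sElt C)) {X : QSet.{u}}
    (F : X ⟶ C.obj) : Fun.pull (F ≫ conj) (sElt C) = star (Fun.pull F (sElt C)) := by
  rw [pull_comp_apply, hconj, map_star]

/-- The `*`-algebra structure on `Fun(X; C)` given by the operations `add`, `mul` and `conj`. -/
noncomputable def funStarAlgebra
    (hadd : Fun.pull add (sElt C) = Fun.pull P.fst (sElt C) + Fun.pull P.snd (sElt C))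
    (hmul : Fun.pull mul (sElt C) = Fun.pull P.fst (sElt C) * Fun.pull P.snd (sElt C))
    (hconj : Fun.pull conj (sElt C) = star (sElt C)) : FunStarAlgebra P add mul conj :=
  -- All operations are transported from ℓ(X) along this bijection. They agree with those induced by
  -- `add`, `mul`, `conj` and `cst` because both sides have the same image under it.
  let e := funEquivEll C
  let ring : ∀ X : QSet.{u}, Ring (X ⟶ C.obj) := fun X => (e X).ring
  let algebra : ∀ X : QSet.{u}, Algebra ℂ (X ⟶ C.obj) := fun X => (e X).algebra ℂ
  have e_add : ∀ (X : QSet.{u}) (F G : X ⟶ C.obj), e X (F + G) = e X F + e X G :=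
    fun X F G => (e X).apply_symm_apply _
  have e_mul : ∀ (X : QSet.{u}) (F G : X ⟶ C.obj), e X (F * G) = e X F * e X G :=
    fun X F G => (e X).apply_symm_apply _
  have e_smul : ∀ (X : QSet.{u}) (c : ℂ) (F : X ⟶ C.obj), e X (c • F) = c • e X F :=
    fun X c F => (e X).apply_symm_apply _
  let starRing : ∀ X : QSet.{u}, StarRing (X ⟶ C.obj) := fun X =>
    { star := fun F => (e X).symm (star (e X F))
      star_involutive := fun F => by
        change (e X).symm (star (e X ((e X).symm (star (e X F))))) = F
        rw [Equiv.apply_symm_apply, star_star, Equiv.symm_apply_apply]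
      star_mul := fun F G => (e X).injective (by
        change e X ((e X).symm (star (e X (F * G)))) =
          e X ((e X).symm (star (e X G)) * (e X).symm (star (e X F)))
        rw [Equiv.apply_symm_apply, e_mul, e_mul, star_mul, Equiv.apply_symm_apply,
          Equiv.apply_symm_apply])
      star_add := fun F G => (e X).injective (by
        change e X ((e X).symm (star (e X (F + G)))) =
          e X ((e X).symm (star (e X F)) + (e X).symm (star (e X G)))
        rw [Equiv.apply_symm_apply, e_add, e_add, star_add, Equiv.apply_symm_apply,
          Equiv.apply_symm_apply]) }
  have e_star : ∀ (X : QSet.{u}) (F : X ⟶ C.obj), e X (star F) = star (e X F) :=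
    fun X F => (e X).apply_symm_apply _
  { ring := ring
    algebra := algebra
    starRing := starRing
    starModule := fun X =>
      ⟨fun c F => (e X).injective (by rw [e_star, e_smul, e_smul, e_star, star_smul])⟩
    add_eq := fun X F G => (e X).injective ((e_add X F G).trans (pull_pair_add hadd F G).symm)
    mul_eq := fun X F G => (e X).injective ((e_mul X F G).trans (pull_pair_mul hmul F G).symm)
    star_eq := fun X F => (e X).injective ((e_star X F).trans (pull_comp_conj hconj F).symm)
    algebraMap_eq := fun X α => (e X).injective (by
      rw [funEquivEll_apply _ (cst C X α), pull_cst]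
      exact (e X).apply_symm_apply _) }

end StarAlgebra

namespace FunStarAlgebra

variable {C : TotalProduct qReal.{u} qReal.{u}} {P : TotalProduct C.obj C.obj}
    {add mul : P.obj ⟶ C.obj} {conj : C.obj ⟶ C.obj} (A : FunStarAlgebra P add mul conj)

/-- For an arbitrary structure `A` only the scalars are prescribed; its unit is recovered as the
scalar 1. -/
theorem cst_one (X : QSet.{u}) : cst C X 1 = (A.ring X).one :=
  (A.algebraMap_eq X 1).symm.trans (A.algebra X).algebraMap.map_one

theorem cst_zero (X : QSet.{u}) : cst C X 0 = (A.ring X).zero :=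
  (A.algebraMap_eq X 0).symm.trans (A.algebra X).algebraMap.map_zero

/-- The unital `*`-homomorphism from `Fun(X; C)` to `ℓ(X)` that takes `F` to `F^⋆(s)`. -/
noncomputable def homEll
    (hadd : Fun.pull add (sElt C) = Fun.pull P.fst (sElt C) + Fun.pull P.snd (sElt C))
    (hmul : Fun.pull mul (sElt C) = Fun.pull P.fst (sElt C) * Fun.pull P.snd (sElt C))
    (hconj : Fun.pull conj (sElt C) = star (sElt C)) (X : QSet.{u}) :
    (A.alg X).carrier →⋆ₐ[ℂ] ell X where
  toFun := fun F : X ⟶ C.obj => Fun.pull F (sElt C)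
  map_one' := (congrArg (fun F : X ⟶ C.obj => Fun.pull F (sElt C)) (A.cst_one X)).symm.trans
    ((pull_cst C X 1).trans (map_one (algebraMap ℂ (ell X))))
  map_zero' := (congrArg (fun F : X ⟶ C.obj => Fun.pull F (sElt C)) (A.cst_zero X)).symm.trans
    ((pull_cst C X 0).trans (map_zero (algebraMap ℂ (ell X))))
  map_add' F G := (congrArg (fun F : X ⟶ C.obj => Fun.pull F (sElt C)) (A.add_eq X F G)).trans
    (pull_pair_add hadd F G)
  map_mul' F G := (congrArg (fun F : X ⟶ C.obj => Fun.pull F (sElt C)) (A.mul_eq X F G)).trans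
    (pull_pair_mul hmul F G)
  commutes' α := (congrArg (fun F : X ⟶ C.obj => Fun.pull F (sElt C))
    (A.algebraMap_eq X α)).trans (pull_cst C X α)
  map_star' F := (congrArg (fun F : X ⟶ C.obj => Fun.pull F (sElt C)) (A.star_eq X F)).trans
    (pull_comp_conj hconj F)

end FunStarAlgebra

/-- A bijective unital `*`-homomorphism is an isomorphism. -/
noncomputable def StarAlgCat.isoOfBijective {A B : StarAlgCat.{u}}
    (f : A.carrier →⋆ₐ[ℂ] B.carrier) (hf : Function.Bijective f) : A ≅ B where
  hom := f
  inv := ((StarAlgEquiv.ofBijective f hf).symm : B.carrier →⋆ₐ[ℂ] A.carrier)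
  hom_inv_id := StarAlgHom.ext (A := A.carrier) (StarAlgEquiv.ofBijective f hf).symm_apply_apply
  inv_hom_id := StarAlgHom.ext (A := B.carrier) (StarAlgEquiv.ofBijective f hf).apply_symm_apply

end QuantumSets

theorem mainTheorem9 :
    Nonempty (TotalProduct qReal.{u} qReal.{u}) ∧
    ∀ C : TotalProduct qReal.{u} qReal.{u},
      Nonempty (TotalProduct C.obj C.obj) ∧
      ∀ P : TotalProduct C.obj C.obj,
        (∃! add : P.obj ⟶ C.obj,
          Fun.pull add (sElt C) = Fun.pull P.fst (sElt C) + Fun.pull P.snd (sElt C)) ∧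
        (∃! mul : P.obj ⟶ C.obj,
          Fun.pull mul (sElt C) = Fun.pull P.fst (sElt C) * Fun.pull P.snd (sElt C)) ∧
        (∃! conj : C.obj ⟶ C.obj, Fun.pull conj (sElt C) = star (sElt C)) ∧
        ∀ (add mul : P.obj ⟶ C.obj) (conj : C.obj ⟶ C.obj),
          Fun.pull add (sElt C) = Fun.pull P.fst (sElt C) + Fun.pull P.snd (sElt C) →
          Fun.pull mul (sElt C) = Fun.pull P.fst (sElt C) * Fun.pull P.snd (sElt C) →
          Fun.pull conj (sElt C) = star (sElt C) →
          ∃ (A : FunStarAlgebra P add mul conj) (η : funFunctor A ≅ ellFunctor.{u}),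
            ∀ (X : QSet.{u}) (F : X ⟶ C.obj),
              StarAlgCat.apply (η.hom.app (Opposite.op X)) F = Fun.pull F (sElt C) := by
  refine ⟨nonempty_totalProduct_qReal, fun C => ⟨nonempty_totalProduct_obj C, fun P =>
    ⟨existsUnique_pull_sElt C _, existsUnique_pull_sElt C _, existsUnique_pull_sElt C _,
      fun add mul conj hadd hmul hconj => ?_⟩⟩⟩
  let A := funStarAlgebra hadd hmul hconj
  refine ⟨A, NatIso.ofComponents (fun X => StarAlgCat.isoOfBijective (A := A.alg X.unop)
    (B := ⟨ell X.unop⟩) (A.homEll hadd hmul hconj X.unop)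
      (funEquivEll C X.unop).bijective) fun {X Y} G => ?_, fun X F => rfl⟩
  -- Naturality is (F ∘ G)^⋆(s) = G^⋆(F^⋆(s)).
  exact StarAlgHom.ext (A := (A.alg X.unop).carrier) fun F => pull_comp_apply G.unop F (sElt C)
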